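/- Let $\mathcal T$ be a good partially truncated triangulation of an oriented 3-manifold $N$: finitely many tetrahedra $\Delta$ are glued by orientation-reversing simplicial pairings of their faces (no face glued to itself, no edge glued to itself with reversed direction); the truncated tetrahedra form a compact oriented manifold $\overline N$ whose boundary components are the vertex links; a vertex is called ideal if its link is a torus, $N$ is $\overline N$ minus its boundary tori, and good means that every tetrahedron has at most one ideal vertex. Let $t$ be the number of tetrahedra, $p$ the number of those having an ideal vertex, $l$ the number of edges of $\mathcal T$ in $N$ without ideal endpoints (compact edges) and $k$ the number of boundary tori. Let $\mathcal W\subset\mathbb R^{6t}$ be the set of dihedral angle assignments $\theta$ with values in $(0,\pi)$ on the edges of the tetrahedra such that the three angles at each vertex have sum $\pi$ if the vertex is ideal and sum $<\pi$ otherwise; it is an open subset of an affine subspace of dimension $6t-p$ and parametrizes the geometric realizations of the tetrahedra. For an edge $ab$ without ideal endpoints of a tetrahedron with vertices $a,b,c,d$, its length is given by $$\cosh L^\theta(ab)=\frac{\cos\theta_{ab}(\cos\theta_{ad}\cos\theta_{bc}+\cos\theta_{ac}\cos\theta_{bd})+\cos\theta_{ac}\cos\theta_{bc}+\cos\theta_{ad}\cos\theta_{bd}+\cos\theta_{cd}\sin^2\theta_{ab}}{\sqrt{d^\theta(a)\,d^\theta(b)}},$$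 where $d^\theta(v)=2\cos\alpha\cos\beta\cos\gamma+\cos^2\alpha+\cos^2\beta+\cos^2\gamma-1$ if $\alpha,\beta,\gamma$ are the angles along the edges at $v$. For a face $vab$ with ideal vertex $v$ and positive cyclic order $(v,a,b)$ in a tetrahedron with remaining vertex $i$, set $\sigma^\theta(vab)=\ln(\sinh L_a/\sinh L_b)$, where $L_a, L_b\ge 0$ are the lengths of the boundary edges of the face at $a$ and $b$, i.e. $$\cosh L_a=\frac{\cos\theta_{av}\cos\theta_{ab}+\cos\theta_{ai}}{\sin\theta_{av}\sin\theta_{ab}},\qquad \cosh L_b=\frac{\cos\theta_{bv}\cos\theta_{ba}+\cos\theta_{bi}}{\sin\theta_{bv}\sin\theta_{ba}}.$$ Choose, for each compact edge of $\mathcal T$, one representative $e'$ among the edges of tetrahedra glued to it, and, for each boundary torus, one pair of glued faces having an ideal vertex on that torus. Let $F$ be the map on $\mathcal W$ whose components are $L^\theta(e)-L^\theta(e')$, for all compact edges $e$ of tetrahedra other than the representatives ($e'$ being the representative of the class of $e$), and $\sigma^\theta(G)+\sigma^\theta(G')$, for all unordered pairs $\{G,G'\}$ of glued faces with an ideal vertex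 other than the chosen ones. Let $\Omega_{\rm c}(\mathcal T)=F^{-1}(0)\subset\mathcal W$ be the space of cone structures. Then $p$ is even, $F$ has exactly $6t-l-\frac32p-k$ components and is smooth, and for every $x\in\mathcal W$ the differential $dF_x\colon T_x\mathcal W\to\mathbb R^{6t-l-\frac32p-k}$ has maximal rank (it is surjective). Consequently $\Omega_{\rm c}(\mathcal T)$ is a smooth (embedded) manifold of real dimension $l+\frac p2+k$ near each of its points. In particular this holds at the point $x_0\in\Omega_{\rm c}(\mathcal T)$ that represents the complete hyperbolic structure with geodesic boundary on $N$, when there is one. -/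

import Mathlib

open scoped ContDiff

noncomputable section

namespace TruncTri

/-! ## Combinatorial triangulations -/

/-- Combinatorial data of a gluing of oriented tetrahedra indexed by `T`.  Each tetrahedron has
vertices `0, 1, 2, 3`, listed in an order compatible with its orientation; its face `i` is the one
opposite to the vertex `i`.  The face `i` of `t` is glued to the face `glue t i i` of `adj t i`, by
the simplicial map sending a vertex `j ≠ i` to `glue t i j`.  The gluing maps reverse the
orientation (the permutations are odd), and no face is glued to itself. -/
structure FacePairing (T : Type*) where
  adj : T → Fin 4 → T
  glue : T → Fin 4 → Equiv.Perm (Fin 4)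
  adj_adj : ∀ t i, adj (adj t i) (glue t i i) = t
  glue_glue : ∀ t i, glue (adj t i) (glue t i i) = (glue t i)⁻¹
  sign_glue : ∀ t i, Equiv.Perm.sign (glue t i) = -1
  face_ne : ∀ t i, (adj t i, glue t i i) ≠ (t, i)

/-- The six edges of a tetrahedron. -/
abbrev TetEdge : Type := {e : Sym2 (Fin 4) // ¬ e.IsDiag}

/-- The directed edges of the tetrahedra: `(t, a, b)` is the edge of `t` from `a` to `b`. -/
abbrev DirEdge (T : Type*) : Type _ := {x : T × Fin 4 × Fin 4 // x.2.1 ≠ x.2.2}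

namespace FacePairing

variable {T : Type*} (P : FacePairing T)

/-- The face glued to a given face. -/
def pairedFace (F : T × Fin 4) : T × Fin 4 := (P.adj F.1 F.2, P.glue F.1 F.2 F.2)

/-- Vertices of tetrahedra that are identified by the gluing of one face. -/
def VertexStep (x y : T × Fin 4) : Prop :=
  ∃ i, i ≠ x.2 ∧ y = (P.adj x.1 i, P.glue x.1 i x.2)

/-- Directed edges of tetrahedra that are identified by the gluing of one face. -/
def DirEdgeStep (x y : DirEdge T) : Prop :=
  ∃ i, i ≠ x.1.2.1 ∧ i ≠ x.1.2.2 ∧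
    y.1 = (P.adj x.1.1 i, P.glue x.1.1 i x.1.2.1, P.glue x.1.1 i x.1.2.2)

/-- Edges of tetrahedra that are identified by the gluing of one face. -/
def EdgeStep (x y : T × TetEdge) : Prop :=
  ∃ i, i ∉ x.2.1 ∧ y.1 = P.adj x.1 i ∧ y.2.1 = Sym2.map (P.glue x.1 i) x.2.1

def vertexSetoid : Setoid (T × Fin 4) := Relation.EqvGen.setoid P.VertexStep

def dirEdgeSetoid : Setoid (DirEdge T) := Relation.EqvGen.setoid P.DirEdgeStep

def edgeSetoid : Setoid (T × TetEdge) := Relation.EqvGen.setoid P.EdgeStep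

/-- Vertices of the triangulation, i.e. boundary components of the compact manifold obtained by
truncating all the vertices. -/
abbrev Vertex : Type _ := Quotient P.vertexSetoid

/-- Edges of the triangulation. -/
abbrev Edge : Type _ := Quotient P.edgeSetoid

/-- Number of truncation triangles in the link of a vertex. -/
def linkTriangles (V : P.Vertex) : ℕ :=
  Nat.card {x : T × Fin 4 // Quotient.mk P.vertexSetoid x = V}

/-- Number of vertices in the link of a vertex `V`: the directed edges of the triangulation
that start at `V`. -/
def linkVertices (V : P.Vertex) : ℕ :=
  Nat.card {D : Quotient P.dirEdgeSetoid //
    ∃ x : DirEdge T, Quotient.mk P.dirEdgeSetoid x = D ∧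
      Quotient.mk P.vertexSetoid (x.1.1, x.1.2.1) = V}

/-- Euler characteristic (vertices minus edges plus triangles) of the link of a vertex.  The link
is a connected closed oriented triangulated surface, the sides of its triangles being glued in
pairs, so that it has `3 / 2` as many edges as triangles. -/
def linkEulerChar (V : P.Vertex) : ℤ :=
  (P.linkVertices V : ℤ) - (3 * (P.linkTriangles V : ℤ)) / 2 + (P.linkTriangles V : ℤ)

end FacePairing

/-- A partially truncated triangulation of an oriented 3-manifold `N`.  No edge is identified with
itself with reversed direction, so truncating all the vertices yields a triangulated compact
oriented manifold `N̄` (every vertex link is a closed oriented surface), and `N` is obtained by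
removing the boundary tori of `N̄`. -/
structure Triangulation (T : Type*) extends FacePairing T where
  edge_not_reversed : ∀ (t : T) (a b : Fin 4) (h : a ≠ b),
    ¬ toFacePairing.dirEdgeSetoid.r ⟨(t, a, b), h⟩ ⟨(t, b, a), h.symm⟩

/-! ## Geometry of a partially truncated tetrahedron -/

/-- The pair `(a, b)` such that `(i, v, a, b)` is an even permutation of `(0, 1, 2, 3)`
(for `i ≠ v`); equivalently, `(v, a, b)` is the positive cyclic order of the vertices of the
face opposite to `i`. -/
def rest : Fin 4 → Fin 4 → Fin 4 × Fin 4
  | 0, 1 => (2, 3) | 0, 2 => (3, 1) | 0, 3 => (1, 2)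
  | 1, 0 => (3, 2) | 1, 2 => (0, 3) | 1, 3 => (2, 0)
  | 2, 0 => (1, 3) | 2, 1 => (3, 0) | 2, 3 => (0, 1)
  | 3, 0 => (2, 1) | 3, 1 => (0, 2) | 3, 2 => (1, 0)
  | _, _ => (0, 0)

theorem rest_spec : ∀ i v : Fin 4, i ≠ v → ∃ π : Equiv.Perm (Fin 4),
    Equiv.Perm.sign π = 1 ∧ π 0 = i ∧ π 1 = v ∧ (π 2, π 3) = rest i v := by
  decide

/-- The dihedral angle along the edge with endpoints `a ≠ b`. -/
def ang (θ : TetEdge → ℝ) (a b : Fin 4) : ℝ :=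
  if h : a = b then 0 else θ ⟨s(a, b), fun h' => h (Sym2.mk_isDiag_iff.mp h')⟩

theorem ang_comm (θ : TetEdge → ℝ) (a b : Fin 4) : ang θ a b = ang θ b a := by
  unfold ang
  by_cases h : a = b
  · simp [h]
  · have h' : ¬ b = a := fun h' => h h'.symm
    simp only [h, h', dite_false]
    congr 1
    exact Subtype.ext Sym2.eq_swap

/-- The sum of the dihedral angles along the three edges emanating from `v`. -/
def angleSum (θ : TetEdge → ℝ) (v : Fin 4) : ℝ := ∑ w ∈ Finset.univ.erase v, ang θ v w

/-- With `v` and its three adjacent edges carrying the angles `α, β, γ`, this is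
`2 cos α cos β cos γ + cos² α + cos² β + cos² γ - 1`. -/
def dFun (θ : TetEdge → ℝ) (v : Fin 4) : ℝ :=
  2 * (∏ w ∈ Finset.univ.erase v, Real.cos (ang θ v w))
    + (∑ w ∈ Finset.univ.erase v, Real.cos (ang θ v w) ^ 2) - 1

/-- The numerator in the length formula for the edge `ab` of a tetrahedron with remaining
vertices `c, d`. -/
def cFun (θ : TetEdge → ℝ) (a b c d : Fin 4) : ℝ :=
  Real.cos (ang θ a b) *
      (Real.cos (ang θ a d) * Real.cos (ang θ b c) + Real.cos (ang θ a c) * Real.cos (ang θ b d))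
    + Real.cos (ang θ a c) * Real.cos (ang θ b c) + Real.cos (ang θ a d) * Real.cos (ang θ b d)
    + Real.cos (ang θ c d) * Real.sin (ang θ a b) ^ 2

/-- The length of the internal edge with endpoints `a ≠ b` (both non-ideal):
`cosh L = c / √(d(a) d(b))`. -/
def internalLength (θ : TetEdge → ℝ) (a b : Fin 4) : ℝ :=
  Real.arcosh (cFun θ a b (rest a b).1 (rest a b).2 / Real.sqrt (dFun θ a * dFun θ b))

theorem internalLength_comm (θ : TetEdge → ℝ) (a b : Fin 4) :
    internalLength θ a b = internalLength θ b a := by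
  have key : cFun θ a b (rest a b).1 (rest a b).2 = cFun θ b a (rest b a).1 (rest b a).2 := by
    have h : (rest b a).1 = (rest a b).2 ∧ (rest b a).2 = (rest a b).1 := by
      revert a b; decide
    rw [h.1, h.2]
    unfold cFun
    rw [ang_comm θ b a, ang_comm θ (rest a b).2 (rest a b).1]
    ring
  unfold internalLength
  rw [key, mul_comm (dFun θ a)]

/-- The length of an internal edge, as a function on unordered edges. -/
def edgeLength (θ : TetEdge → ℝ) (e : TetEdge) : ℝ :=
  Sym2.lift ⟨internalLength θ, internalLength_comm θ⟩ e.1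

/-- The length of the boundary edge at the non-ideal vertex `a` joining the internal edges `ax` and
`ay`, where `z` is the remaining vertex. -/
def boundaryLength (θ : TetEdge → ℝ) (a x y z : Fin 4) : ℝ :=
  Real.arcosh ((Real.cos (ang θ a x) * Real.cos (ang θ a y) + Real.cos (ang θ a z)) /
    (Real.sin (ang θ a x) * Real.sin (ang θ a y)))

/-- The invariant `σ` of the face opposite to `i` of a tetrahedron, when that face is exceptional
with ideal vertex `v ≠ i`: if `(v, a, b)` is the positive cyclic order of its vertices, this is the
logarithm of the ratio of the hyperbolic sines of the lengths of its boundary edges at `a`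
and `b`. -/
def sigmaAt (θ : TetEdge → ℝ) (i v : Fin 4) : ℝ :=
  Real.log (Real.sinh (boundaryLength θ (rest i v).1 v (rest i v).2 i) /
    Real.sinh (boundaryLength θ (rest i v).2 v (rest i v).1 i))

/-! ## Moduli space and consistency equations -/

namespace Triangulation

variable {T : Type*} (𝒯 : Triangulation T)

/-- A vertex of the triangulation is ideal if its link is a torus. -/
def IsIdealVertex (V : 𝒯.Vertex) : Prop := 𝒯.linkEulerChar V = 0

/-- The vertex `v` of the tetrahedron `t` is ideal. -/
def IsIdeal (t : T) (v : Fin 4) : Prop := 𝒯.IsIdealVertex (Quotient.mk 𝒯.vertexSetoid (t, v))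

/-- A triangulation is good if every tetrahedron has at most one ideal vertex. -/
def IsGood : Prop := ∀ t v w, 𝒯.IsIdeal t v → 𝒯.IsIdeal t w → v = w

/-- The boundary tori of `N̄`, i.e. the toric cusps of `N`. -/
abbrev Cusp : Type _ := {V : 𝒯.Vertex // 𝒯.IsIdealVertex V}

/-- The number `k` of toric cusps. -/
def numCusps : ℕ := Nat.card 𝒯.Cusp

/-- The number `p` of non-compact tetrahedra. -/
def numNoncompactTets : ℕ := Nat.card {t : T // ∃ v, 𝒯.IsIdeal t v}

/-- An edge of a tetrahedron is compact if it has no ideal endpoint. -/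
def IsCompactEdge (x : T × TetEdge) : Prop := ∀ v ∈ x.2.1, ¬ 𝒯.IsIdeal x.1 v

/-- The edges of the triangulation without ideal endpoints. -/
abbrev CompactEdge : Type _ :=
  {E : 𝒯.Edge // ∃ x, Quotient.mk 𝒯.edgeSetoid x = E ∧ 𝒯.IsCompactEdge x}

/-- The number `l` of edges of the triangulation without ideal endpoints. -/
def numCompactEdges : ℕ := Nat.card 𝒯.CompactEdge

/-- A lateral hexagon (face of a tetrahedron) is exceptional if it has an ideal vertex. -/
def IsExceptional (F : T × Fin 4) : Prop := ∃ v, v ≠ F.2 ∧ 𝒯.IsIdeal F.1 v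

/-- The moduli space `W ⊆ ℝ^{6t}` of geometric realizations of the tetrahedra, in terms of
dihedral angles. -/
def moduli : Set (T × TetEdge → ℝ) :=
  {x | (∀ t e, x (t, e) ∈ Set.Ioo 0 Real.pi) ∧
    ∀ t v, (𝒯.IsIdeal t v → angleSum (fun e => x (t, e)) v = Real.pi) ∧
      (¬ 𝒯.IsIdeal t v → angleSum (fun e => x (t, e)) v < Real.pi)}

/-- The tangent space to `W` at any of its points: the direction of the affine subspace of `ℝ^{6t}`
in which `W` is open. -/
def moduliTangent : Submodule ℝ (T × TetEdge → ℝ) where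
  carrier := {ξ | ∀ t v, 𝒯.IsIdeal t v → angleSum (fun e => ξ (t, e)) v = 0}
  add_mem' := by
    intro ξ η hξ hη t v h
    have h1 := hξ t v h
    have h2 := hη t v h
    have : angleSum (fun e => (ξ + η) (t, e)) v
        = angleSum (fun e => ξ (t, e)) v + angleSum (fun e => η (t, e)) v := by
      unfold angleSum
      rw [← Finset.sum_add_distrib]
      refine Finset.sum_congr rfl fun w _ => ?_
      unfold ang
      split_ifs <;> simp
    rw [this, h1, h2, add_zero]
  zero_mem' := by
    intro t v _
    unfold angleSum
    refine Finset.sum_eq_zero fun w _ => ?_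
    unfold ang
    split_ifs <;> simp
  smul_mem' := by
    intro c ξ hξ t v h
    have h1 := hξ t v h
    have : angleSum (fun e => (c • ξ) (t, e)) v = c * angleSum (fun e => ξ (t, e)) v := by
      unfold angleSum
      rw [Finset.mul_sum]
      refine Finset.sum_congr rfl fun w _ => ?_
      unfold ang
      split_ifs <;> simp
    rw [this, h1, mul_zero]

open Classical in
/-- The value of `σ` on an exceptional lateral hexagon. -/
def sigma (x : T × TetEdge → ℝ) (F : T × Fin 4) : ℝ :=
  if h : 𝒯.IsExceptional F then sigmaAt (fun e => x (F.1, e)) F.2 h.choose else 0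

/-- The choice of a non-redundant system of matching equations: for every compact edge of the
triangulation, one of the tetrahedral edges in its class, to which the lengths of the others are
compared; for every cusp, an exceptional hexagon incident to that cusp, whose `σ`-equation is
discarded. -/
structure EquationChoice where
  base : 𝒯.CompactEdge → T × TetEdge
  base_spec : ∀ E, Quotient.mk 𝒯.edgeSetoid (base E) = E.1
  drop : 𝒯.Cusp → T × Fin 4
  drop_spec : ∀ κ, ∃ v, v ≠ (drop κ).2 ∧ Quotient.mk 𝒯.vertexSetoid ((drop κ).1, v) = κ.1

namespace EquationChoice

variable {𝒯} (ch : 𝒯.EquationChoice)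

/-- The compact edges of tetrahedra other than the chosen representatives.  They index the
length equations. -/
abbrev LengthEq : Type _ := {x : T × TetEdge // 𝒯.IsCompactEdge x ∧ ∀ E, ch.base E ≠ x}

/-- The unordered pairs of matching exceptional hexagons other than the discarded ones.  They index
the `σ`-equations. -/
abbrev SigmaEq (ch : 𝒯.EquationChoice) : Type _ :=
  {q : Sym2 (T × Fin 4) // (∃ F, 𝒯.IsExceptional F ∧ q = s(F, 𝒯.pairedFace F)) ∧
    ∀ κ, q ≠ s(ch.drop κ, 𝒯.pairedFace (ch.drop κ))}

abbrev EqIndex : Type _ := ch.LengthEq ⊕ ch.SigmaEq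

instance [Finite T] : Fintype ch.LengthEq := Fintype.ofFinite _

instance [Finite T] : Fintype ch.SigmaEq := Fintype.ofFinite _

/-- The map `F`, given by the same formulas on all of `ℝ^{6t}`; it is meaningful on `W`.  Its
components are `L(e) - L(e')`, for `e` a compact edge of a tetrahedron and `e'` the chosen
representative of its class, and `σ(F) + σ(F')`, for `{F, F'}` a pair of matching exceptional
hexagons. -/
def matchingMap (x : T × TetEdge → ℝ) : ch.EqIndex → ℝ
  | Sum.inl y =>
      edgeLength (fun e => x (y.1.1, e)) y.1.2 -
        (let b := ch.base ⟨Quotient.mk 𝒯.edgeSetoid y.1, y.1, rfl, y.2.1⟩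
         edgeLength (fun e => x (b.1, e)) b.2)
  | Sum.inr q => Sym2.lift ⟨fun F F' => 𝒯.sigma x F + 𝒯.sigma x F', fun _ _ => add_comm _ _⟩ q.1

/-- The space `Ω_c = F⁻¹(0) ⊆ W` of cone structures. -/
def coneStructures : Set (T × TetEdge → ℝ) := {x | x ∈ 𝒯.moduli ∧ ch.matchingMap x = 0}

end EquationChoice

end Triangulation

/-- Near its point `x₀`, the set `S` is a smooth (embedded) submanifold of dimension `n` of
the normed space `E`: some smooth chart of `E` around `x₀` carries `S` to the slice
`ℝⁿ × {0}` of `ℝⁿ × ℝ^q`. -/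
def IsSmoothManifoldNear {E : Type*} [NormedAddCommGroup E] [NormedSpace ℝ E]
    (S : Set E) (n : ℕ) (x₀ : E) : Prop :=
  x₀ ∈ S ∧ ∃ (q : ℕ) (φ : OpenPartialHomeomorph E ((Fin n → ℝ) × (Fin q → ℝ))),
    x₀ ∈ φ.source ∧ ContDiffOn ℝ ∞ φ φ.source ∧ ContDiffOn ℝ ∞ φ.symm φ.target ∧
      ∀ x ∈ φ.source, x ∈ S ↔ (φ x).2 = 0

end TruncTri

end

/-!
A single tetrahedron is infinitesimally rigid.  Each of its hexagonal faces is a right-angled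
hexagon whose boundary edges are determined, by the hyperbolic cosine rule, by the three edges
without ideal endpoints; if the face has an ideal vertex, the hexagon degenerates to a pentagon,
whose two boundary edges are determined by its one remaining edge and by `σ`.  The boundary edges
at a vertex are in turn the sides of a truncation triangle and determine its angles.  Hence the
differentials of the lengths, of the `σ` and of the angle sum at the ideal vertex have no common
kernel.  The three `σ` at an ideal vertex have sum zero, and by counting dimensions this is the only
linear relation between these differentials.

The variations of the `σ` can therefore be prescribed on all the faces with an ideal vertex,
provided that they have sum zero at each ideal vertex.  A variation which meets the
`σ`-equations is first chosen on pairs of glued faces, and its sums at the ideal vertices are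
then corrected by moving mass across glued faces; as the link of an ideal vertex is connected,
the excess can be brought to the pair of faces that has been discarded for this cusp, where it
is absorbed.  This shows that the matching map, extended by the angle sums at the ideal
vertices, is a submersion, and its level sets are manifolds by the inverse function theorem. -/


open scoped ContDiff

noncomputable section

namespace TruncTri

open Filter Topology

section LineDerivative

variable {𝕜 E F F' G : Type*} [NontriviallyNormedField 𝕜]
  [NormedAddCommGroup E] [NormedSpace 𝕜 E] [NormedAddCommGroup F] [NormedSpace 𝕜 F]
  [NormedAddCommGroup F'] [NormedSpace 𝕜 F'] [NormedAddCommGroup G] [NormedSpace 𝕜 G]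
  {x v : E}

theorem hasLineDerivAt_zero_of_comp_eventuallyEq {f : E → F} {g : E → G} {Φ : F → G}
    (hf : HasLineDerivAt 𝕜 f 0 x v) (hΦ : DifferentiableAt 𝕜 Φ (f x))
    (h : ∀ᶠ y in 𝓝 x, Φ (f y) = g y) : HasLineDerivAt 𝕜 g 0 x v := by
  have hcomp : HasLineDerivAt 𝕜 (Φ ∘ f) 0 x v := by
    have hΦ' : HasFDerivAt Φ (fderiv 𝕜 Φ (f x)) (f (x + (0 : 𝕜) • v)) := by
      simpa using hΦ.hasFDerivAt
    simpa [HasLineDerivAt, Function.comp_def] using hΦ'.comp_hasDerivAt (0 : 𝕜) hf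
  exact hcomp.congr_of_eventuallyEq (h.mono fun _ hy => hy.symm)

theorem hasLineDerivAt_zero_comp {f : E → F} {Φ : F → G}
    (hf : HasLineDerivAt 𝕜 f 0 x v) (hΦ : DifferentiableAt 𝕜 Φ (f x)) :
    HasLineDerivAt 𝕜 (fun y => Φ (f y)) 0 x v :=
  hasLineDerivAt_zero_of_comp_eventuallyEq hf hΦ (.of_forall fun _ => rfl)

theorem hasLineDerivAt_zero_prodMk {f : E → F} {g : E → F'}
    (hf : HasLineDerivAt 𝕜 f 0 x v) (hg : HasLineDerivAt 𝕜 g 0 x v) :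
    HasLineDerivAt 𝕜 (fun y => (f y, g y)) 0 x v :=
  HasDerivAt.prodMk hf hg

end LineDerivative

section CosineRule

/-- Minus the determinant of the Gram matrix of three vectors of square length `1` whose pairwise
products are `-x`, `-y`, `-z`. -/
def gram (x y z : ℝ) : ℝ := x ^ 2 + y ^ 2 + z ^ 2 + 2 * x * y * z - 1

/-- The common shape of two hyperbolic cosine rules.  If `x`, `y`, `z` are the hyperbolic cosines of
three pairwise non-adjacent sides of a right-angled hexagon, this is the hyperbolic cosine of the
side between the first two; if they are the cosines of the angles of a triangle, this is the
hyperbolic cosine of the side joining the first two.  Keeping the product of the two factors under a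
single square root makes sense of both cases, `x ^ 2 - 1` being negative in the second one. -/
def cosineRule (x y z : ℝ) : ℝ := (x * y + z) / √((x ^ 2 - 1) * (y ^ 2 - 1))

variable {x y z : ℝ}

theorem cosineRule_comm (x y z : ℝ) : cosineRule x y z = cosineRule y x z := by
  rw [cosineRule, cosineRule, mul_comm x, mul_comm (x ^ 2 - 1)]

theorem gram_swap (x y z : ℝ) : gram x z y = gram x y z := by
  unfold gram
  ring

theorem cosineRule_sq_sub_one (h : 0 < (x ^ 2 - 1) * (y ^ 2 - 1)) :
    cosineRule x y z ^ 2 - 1 = gram x y z / ((x ^ 2 - 1) * (y ^ 2 - 1)) := by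
  rw [cosineRule, div_pow, Real.sq_sqrt h.le, div_sub_one h.ne', gram]
  ring

theorem cosineRule_cosineRule {ε : ℝ} (hε : ε * |x ^ 2 - 1| = x ^ 2 - 1)
    (hxy : 0 < (x ^ 2 - 1) * (y ^ 2 - 1)) (hxz : 0 < (x ^ 2 - 1) * (z ^ 2 - 1))
    (hgram : 0 < gram x y z) :
    cosineRule (cosineRule x y z) (cosineRule x z y) (ε * cosineRule y z x) = x := by
  have hx : 0 < |x ^ 2 - 1| := abs_pos.2 (left_ne_zero_of_mul hxy.ne')
  have hyz : 0 < (y ^ 2 - 1) * (z ^ 2 - 1) := by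
    have := mul_pos hxy hxz
    rw [mul_mul_mul_comm] at this
    exact (pos_iff_pos_of_mul_pos this).1 (mul_self_pos.2 (left_ne_zero_of_mul hxy.ne'))
  set s := √((y ^ 2 - 1) * (z ^ 2 - 1)) with hs
  have hs0 : 0 < s := Real.sqrt_pos.2 hyz
  have hsqrt : √((x ^ 2 - 1) * (y ^ 2 - 1)) * √((x ^ 2 - 1) * (z ^ 2 - 1)) = |x ^ 2 - 1| * s := by
    rw [← Real.sqrt_mul hxy.le, mul_mul_mul_comm, Real.sqrt_mul (mul_self_nonneg _),
      Real.sqrt_mul_self_eq_abs]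
  have hnumer : cosineRule x y z * cosineRule x z y + ε * cosineRule y z x =
      x * gram x y z / (|x ^ 2 - 1| * s) := by
    rw [cosineRule, cosineRule, cosineRule, div_mul_div_comm, hsqrt, ← hs]
    field_simp
    rw [mul_comm |x ^ 2 - 1| ε, hε, gram]
    ring
  have hdenom : √((cosineRule x y z ^ 2 - 1) * (cosineRule x z y ^ 2 - 1)) =
      gram x y z / (|x ^ 2 - 1| * s) := by
    rw [cosineRule_sq_sub_one hxy, cosineRule_sq_sub_one hxz, gram_swap x y z, div_mul_div_comm,
      Real.sqrt_div (mul_self_nonneg _), Real.sqrt_mul_self hgram.le, Real.sqrt_mul hxy.le, hsqrt]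
  rw [cosineRule, hnumer, hdenom, div_div_div_cancel_right₀ (by positivity),
    mul_div_cancel_right₀ _ hgram.ne']

theorem one_lt_cosineRule_iff (h : 0 < (x ^ 2 - 1) * (y ^ 2 - 1)) :
    1 < cosineRule x y z ↔ √((x ^ 2 - 1) * (y ^ 2 - 1)) < x * y + z :=
  one_lt_div (Real.sqrt_pos.2 h)

theorem sq_sub_one_pos (hx : 1 < x) : 0 < x ^ 2 - 1 :=
  sub_pos.2 (one_lt_pow₀ hx two_ne_zero)

theorem one_lt_cosineRule (hx : 1 < x) (hy : 1 < y) (hz : -1 < z) : 1 < cosineRule x y z := by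
  rw [one_lt_cosineRule_iff (mul_pos (sq_sub_one_pos hx) (sq_sub_one_pos hy))]
  calc √((x ^ 2 - 1) * (y ^ 2 - 1)) ≤ x * y - 1 :=
        Real.sqrt_le_iff.2 ⟨by nlinarith, by nlinarith [sq_nonneg (x - y)]⟩
    _ < x * y + z := by linarith

theorem gram_pos (hx : 1 < x) (hy : 1 < y) (hz : -1 < z) : 0 < gram x y z := by
  have h := mul_pos (sq_sub_one_pos hx) (sq_sub_one_pos hy)
  have hlt := sq_sub_one_pos (one_lt_cosineRule hx hy hz)
  rwa [cosineRule_sq_sub_one h, div_pos_iff_of_pos_right h] at hlt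

/-- In a right-angled pentagon, obtained from a hexagon by letting a side shrink to an ideal
vertex, two sides are determined by the side between them and the ratio of their hyperbolic
sines. -/
theorem cosineRule_one_add_div (hx : 1 < x) (hy : 1 < y) :
    (cosineRule x y 1 + √(x ^ 2 - 1) / √(y ^ 2 - 1)) / √(cosineRule x y 1 ^ 2 - 1) = x := by
  have hx' := sq_sub_one_pos hx
  have hy' := sq_sub_one_pos hy
  have hgram : gram x y 1 = (x + y) ^ 2 := by
    unfold gram
    ring
  rw [cosineRule_sq_sub_one (mul_pos hx' hy'), hgram, Real.sqrt_div (sq_nonneg _),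
    Real.sqrt_sq (by linarith), cosineRule, Real.sqrt_mul hx'.le]
  have hsq := Real.sq_sqrt hx'.le
  have hpos := Real.sqrt_pos.2 hx'
  have := Real.sqrt_pos.2 hy'
  generalize √(x ^ 2 - 1) = u at *
  have : x + y ≠ 0 := by linarith
  field_simp
  rw [hsq]
  ring

variable {E : Type*} [NormedAddCommGroup E] [NormedSpace ℝ E] {f g h : E → ℝ} {p v : E}

theorem contDiffAt_cosineRule {n : ℕ∞ω} (hf : ContDiffAt ℝ n f p) (hg : ContDiffAt ℝ n g p)
    (hh : ContDiffAt ℝ n h p) (hfg : 0 < (f p ^ 2 - 1) * (g p ^ 2 - 1)) :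
    ContDiffAt ℝ n (fun y => cosineRule (f y) (g y) (h y)) p := by
  unfold cosineRule
  have : √((f p ^ 2 - 1) * (g p ^ 2 - 1)) ≠ 0 := (Real.sqrt_pos.2 hfg).ne'
  fun_prop (disch := first | assumption | exact hfg.ne')

theorem hasLineDerivAt_zero_cosineRule (hf : HasLineDerivAt ℝ f 0 p v)
    (hg : HasLineDerivAt ℝ g 0 p v) (hh : HasLineDerivAt ℝ h 0 p v)
    (hfg : 0 < (f p ^ 2 - 1) * (g p ^ 2 - 1)) :
    HasLineDerivAt ℝ (fun y => cosineRule (f y) (g y) (h y)) 0 p v :=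
  hasLineDerivAt_zero_comp (Φ := fun q : ℝ × ℝ × ℝ => cosineRule q.1 q.2.1 q.2.2)
    (hasLineDerivAt_zero_prodMk hf (hasLineDerivAt_zero_prodMk hg hh))
    ((contDiffAt_cosineRule (n := 1) contDiffAt_fst contDiffAt_snd.fst contDiffAt_snd.snd
      hfg).differentiableAt one_ne_zero)

theorem hasLineDerivAt_zero_of_cosineRule {ε : ℝ}
    (hε : ∀ᶠ y in 𝓝 p, ε * |f y ^ 2 - 1| = f y ^ 2 - 1)
    (hfg : ∀ᶠ y in 𝓝 p, 0 < (f y ^ 2 - 1) * (g y ^ 2 - 1))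
    (hfh : ∀ᶠ y in 𝓝 p, 0 < (f y ^ 2 - 1) * (h y ^ 2 - 1))
    (hgram : ∀ᶠ y in 𝓝 p, 0 < gram (f y) (g y) (h y))
    (h₁ : HasLineDerivAt ℝ (fun y => cosineRule (f y) (g y) (h y)) 0 p v)
    (h₂ : HasLineDerivAt ℝ (fun y => cosineRule (f y) (h y) (g y)) 0 p v)
    (h₃ : HasLineDerivAt ℝ (fun y => cosineRule (g y) (h y) (f y)) 0 p v) :
    HasLineDerivAt ℝ f 0 p v := by
  have hpos : 0 < (cosineRule (f p) (g p) (h p) ^ 2 - 1) *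
      (cosineRule (f p) (h p) (g p) ^ 2 - 1) := by
    rw [cosineRule_sq_sub_one hfg.self_of_nhds, cosineRule_sq_sub_one hfh.self_of_nhds,
      gram_swap (f p) (g p)]
    exact mul_pos (div_pos hgram.self_of_nhds hfg.self_of_nhds)
      (div_pos hgram.self_of_nhds hfh.self_of_nhds)
  have h₃' := hasLineDerivAt_zero_comp h₃ (Φ := fun t => ε * t) (by fun_prop)
  refine (hasLineDerivAt_zero_cosineRule h₁ h₂ h₃' hpos).congr_of_eventuallyEq ?_
  filter_upwards [hε, hfg, hfh, hgram] with y hε hfg hfh hgram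
  exact (cosineRule_cosineRule hε hfg hfh hgram).symm

theorem hasLineDerivAt_zero_of_hexagon (hf : ∀ᶠ y in 𝓝 p, 1 < f y)
    (hg : ∀ᶠ y in 𝓝 p, 1 < g y) (hh : ∀ᶠ y in 𝓝 p, 1 < h y)
    (h₁ : HasLineDerivAt ℝ (fun y => cosineRule (f y) (g y) (h y)) 0 p v)
    (h₂ : HasLineDerivAt ℝ (fun y => cosineRule (f y) (h y) (g y)) 0 p v)
    (h₃ : HasLineDerivAt ℝ (fun y => cosineRule (g y) (h y) (f y)) 0 p v) :
    HasLineDerivAt ℝ f 0 p v := by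
  refine hasLineDerivAt_zero_of_cosineRule (ε := 1) ?_ ?_ ?_ ?_ h₁ h₂ h₃ <;>
    filter_upwards [hf, hg, hh] with y hf hg hh
  · rw [one_mul, abs_of_pos (sq_sub_one_pos hf)]
  · exact mul_pos (sq_sub_one_pos hf) (sq_sub_one_pos hg)
  · exact mul_pos (sq_sub_one_pos hf) (sq_sub_one_pos hh)
  · exact gram_pos hf hg (by linarith)

theorem hasLineDerivAt_zero_of_pentagon (hf : ∀ᶠ y in 𝓝 p, 1 < f y) (hg : ∀ᶠ y in 𝓝 p, 1 < g y)
    (hside : HasLineDerivAt ℝ (fun y => cosineRule (f y) (g y) 1) 0 p v)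
    (hratio : HasLineDerivAt ℝ (fun y => √(f y ^ 2 - 1) / √(g y ^ 2 - 1)) 0 p v) :
    HasLineDerivAt ℝ f 0 p v := by
  have hpos := sq_sub_one_pos (one_lt_cosineRule hf.self_of_nhds hg.self_of_nhds (z := 1) (by simp))
  refine hasLineDerivAt_zero_of_comp_eventuallyEq
    (Φ := fun q : ℝ × ℝ => (q.1 + q.2) / √(q.1 ^ 2 - 1))
    (hasLineDerivAt_zero_prodMk hside hratio) ?_ ?_
  · have := (Real.sqrt_pos.2 hpos).ne'
    fun_prop (disch := first | assumption | exact hpos.ne')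
  · filter_upwards [hf, hg] with y hf hg using cosineRule_one_add_div hf hg

end CosineRule

section Triangle

open Real

variable {α β γ : ℝ}

theorem sqrt_cos_sq_sub_one_mul (hα : α ∈ Set.Ioo 0 π) (hβ : β ∈ Set.Ioo 0 π) :
    √((cos α ^ 2 - 1) * (cos β ^ 2 - 1)) = sin α * sin β := by
  have h : (cos α ^ 2 - 1) * (cos β ^ 2 - 1) = (sin α * sin β) ^ 2 := by
    rw [cos_sq', cos_sq']
    ring
  rw [h, sqrt_sq (mul_pos (sin_pos_of_mem_Ioo hα) (sin_pos_of_mem_Ioo hβ)).le]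

theorem cos_sq_sub_one_mul_pos (hα : α ∈ Set.Ioo 0 π) (hβ : β ∈ Set.Ioo 0 π) :
    0 < (cos α ^ 2 - 1) * (cos β ^ 2 - 1) := by
  rw [← sqrt_pos, sqrt_cos_sq_sub_one_mul hα hβ]
  exact mul_pos (sin_pos_of_mem_Ioo hα) (sin_pos_of_mem_Ioo hβ)

theorem one_lt_cosineRule_cos (hα : α ∈ Set.Ioo 0 π) (hβ : β ∈ Set.Ioo 0 π) (hγ : 0 < γ)
    (h : α + β + γ < π) : 1 < cosineRule (cos α) (cos β) (cos γ) := by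
  rw [one_lt_cosineRule_iff (cos_sq_sub_one_mul_pos hα hβ), sqrt_cos_sq_sub_one_mul hα hβ]
  have hlt : cos (π - (α + β)) < cos γ :=
    cos_lt_cos_of_nonneg_of_le_pi hγ.le (by linarith [hα.1, hβ.1]) (by linarith)
  rw [cos_pi_sub, cos_add] at hlt
  linarith

theorem cosineRule_cos_eq_one (hα : α ∈ Set.Ioo 0 π) (hβ : β ∈ Set.Ioo 0 π)
    (h : α + β + γ = π) : cosineRule (cos α) (cos β) (cos γ) = 1 := by
  have hα' := sin_pos_of_mem_Ioo hα
  have hβ' := sin_pos_of_mem_Ioo hβ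
  rw [cosineRule, sqrt_cos_sq_sub_one_mul hα hβ, show γ = π - (α + β) by linarith, cos_pi_sub,
    cos_add, div_eq_one_iff_eq (by positivity)]
  ring

theorem neg_one_lt_cosineRule_cos (hα : α ∈ Set.Ioo 0 π) (hβ : β ∈ Set.Ioo 0 π)
    (hγ : γ ∈ Set.Ioo 0 π) (h₁ : α + γ < π + β) (h₂ : β + γ < π + α) :
    -1 < cosineRule (cos α) (cos β) (cos γ) := by
  have hα' := sin_pos_of_mem_Ioo hα
  have hβ' := sin_pos_of_mem_Ioo hβ
  have hlt : cos (π - γ) < cos (α - β) := by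
    rw [← cos_abs (α - β)]
    refine cos_lt_cos_of_nonneg_of_le_pi (abs_nonneg _) (by linarith [hγ.1]) ?_
    exact abs_lt.2 ⟨by linarith, by linarith⟩
  rw [cos_pi_sub, cos_sub] at hlt
  rw [cosineRule, sqrt_cos_sq_sub_one_mul hα hβ, lt_div_iff₀ (by positivity)]
  linarith

theorem gram_cos_pos (hα : α ∈ Set.Ioo 0 π) (hβ : β ∈ Set.Ioo 0 π) (hγ : 0 < γ)
    (h : α + β + γ < π) : 0 < gram (cos α) (cos β) (cos γ) := by
  have hpos := cos_sq_sub_one_mul_pos hα hβ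
  have hlt := sq_sub_one_pos (one_lt_cosineRule_cos hα hβ hγ h)
  rwa [cosineRule_sq_sub_one hpos, div_pos_iff_of_pos_right hpos] at hlt

variable {E : Type*} [NormedAddCommGroup E] [NormedSpace ℝ E] {f g h : E → ℝ} {p v : E}

theorem hasLineDerivAt_zero_cos_of_triangle (hf : ∀ᶠ y in 𝓝 p, f y ∈ Set.Ioo 0 π)
    (hg : ∀ᶠ y in 𝓝 p, g y ∈ Set.Ioo 0 π) (hh : ∀ᶠ y in 𝓝 p, h y ∈ Set.Ioo 0 π)
    (hsum : ∀ᶠ y in 𝓝 p, f y + g y + h y < π)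
    (h₁ : HasLineDerivAt ℝ (fun y => cosineRule (cos (f y)) (cos (g y)) (cos (h y))) 0 p v)
    (h₂ : HasLineDerivAt ℝ (fun y => cosineRule (cos (f y)) (cos (h y)) (cos (g y))) 0 p v)
    (h₃ : HasLineDerivAt ℝ (fun y => cosineRule (cos (g y)) (cos (h y)) (cos (f y))) 0 p v) :
    HasLineDerivAt ℝ (fun y => cos (f y)) 0 p v := by
  refine hasLineDerivAt_zero_of_cosineRule (ε := -1) ?_ ?_ ?_ ?_ h₁ h₂ h₃ <;>
    filter_upwards [hf, hg, hh, hsum] with y hf hg hh hsum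
  · rw [abs_of_nonpos (by linarith [cos_sq_le_one (f y)])]
    ring
  · exact cos_sq_sub_one_mul_pos hf hg
  · exact cos_sq_sub_one_mul_pos hf hh
  · exact gram_cos_pos hf hg hh.1 hsum

end Triangle

section Vertices

/-- `a`, `b`, `c`, `d` are the four vertices of a tetrahedron, in some order. -/
def AllDistinct (a b c d : Fin 4) : Prop := a ≠ b ∧ a ≠ c ∧ a ≠ d ∧ b ≠ c ∧ b ≠ d ∧ c ≠ d

instance (a b c d : Fin 4) : Decidable (AllDistinct a b c d) :=
  inferInstanceAs (Decidable (_ ∧ _))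

variable {a b c d : Fin 4}

theorem AllDistinct.swap₁₂ (h : AllDistinct a b c d) : AllDistinct b a c d :=
  ⟨h.1.symm, h.2.2.2.1, h.2.2.2.2.1, h.2.1, h.2.2.1, h.2.2.2.2.2⟩

theorem AllDistinct.swap₂₃ (h : AllDistinct a b c d) : AllDistinct a c b d :=
  ⟨h.2.1, h.1, h.2.2.1, h.2.2.2.1.symm, h.2.2.2.2.2, h.2.2.2.2.1⟩

theorem AllDistinct.swap₃₄ (h : AllDistinct a b c d) : AllDistinct a b d c :=
  ⟨h.1, h.2.2.1, h.2.1, h.2.2.2.2.1, h.2.2.2.1, h.2.2.2.2.2.symm⟩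

theorem AllDistinct.sum_erase {M : Type*} [AddCommMonoid M] (h : AllDistinct a b c d)
    (f : Fin 4 → M) : ∑ w ∈ Finset.univ.erase a, f w = f b + f c + f d := by
  obtain ⟨-, -, -, hbc, hbd, hcd⟩ := id h
  have herase : ∀ a b c d : Fin 4, AllDistinct a b c d → Finset.univ.erase a = {b, c, d} := by
    decide
  rw [herase a b c d h, Finset.sum_insert (by simp [hbc, hbd]), Finset.sum_pair hcd, add_assoc]

theorem exists_allDistinct : ∀ {a b : Fin 4}, a ≠ b → ∃ c d, AllDistinct a b c d := by
  decide

theorem rest_eq_or_eq : ∀ {a b c d : Fin 4}, AllDistinct a b c d →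
    rest a b = (c, d) ∨ rest a b = (d, c) := by
  decide

theorem allDistinct_rest : ∀ {a b : Fin 4}, a ≠ b → AllDistinct a b (rest a b).1 (rest a b).2 := by
  decide

theorem exists_rest_cyclic : ∀ v : Fin 4, ∃ a b c, AllDistinct v a b c ∧
    rest a v = (b, c) ∧ rest b v = (c, a) ∧ rest c v = (a, b) := by
  decide

theorem sum_sub_rest {M : Type*} [AddCommGroup M] (f : Fin 4 → M) (v : Fin 4) :
    ∑ i ∈ Finset.univ.erase v, (f (rest i v).1 - f (rest i v).2) = 0 := by
  obtain ⟨a, b, c, h, ha, hb, hc⟩ := exists_rest_cyclic v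
  rw [h.sum_erase, ha, hb, hc]
  abel

theorem TetEdge.exists_eq_mk (e : TetEdge) :
    ∃ a b, ∃ h : a ≠ b, e = ⟨s(a, b), mt Sym2.mk_isDiag_iff.mp h⟩ := by
  obtain ⟨e, he⟩ := e
  induction e with
  | h a b => exact ⟨a, b, mt Sym2.mk_isDiag_iff.mpr he, rfl⟩

end Vertices

section Angles

open Real

theorem ang_of_ne {a b : Fin 4} (h : a ≠ b) (θ : TetEdge → ℝ) :
    ang θ a b = θ ⟨s(a, b), mt Sym2.mk_isDiag_iff.mp h⟩ :=
  dif_neg h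

/-- The dihedral angle along an edge, as a linear function of the angles. -/
def angCLM (a b : Fin 4) : (TetEdge → ℝ) →L[ℝ] ℝ :=
  if h : a = b then 0 else ContinuousLinearMap.proj ⟨s(a, b), mt Sym2.mk_isDiag_iff.mp h⟩

@[simp]
theorem angCLM_apply (a b : Fin 4) (θ : TetEdge → ℝ) : angCLM a b θ = ang θ a b := by
  unfold angCLM ang
  split_ifs <;> rfl

/-- The sum of the dihedral angles at a vertex, as a linear function of the angles. -/
def angleSumCLM (v : Fin 4) : (TetEdge → ℝ) →L[ℝ] ℝ := ∑ w ∈ Finset.univ.erase v, angCLM v w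

@[simp]
theorem angleSumCLM_apply (v : Fin 4) (θ : TetEdge → ℝ) : angleSumCLM v θ = angleSum θ v := by
  simp [angleSumCLM, angleSum]

theorem angleSum_add_smul (θ ξ : TetEdge → ℝ) (s : ℝ) (v : Fin 4) :
    angleSum (θ + s • ξ) v = angleSum θ v + s * angleSum ξ v := by
  simp only [← angleSumCLM_apply, map_add, map_smul, smul_eq_mul]

@[fun_prop]
theorem contDiff_ang (a b : Fin 4) {n : ℕ∞ω} : ContDiff ℝ n fun θ => ang θ a b := by
  simpa only [← angCLM_apply] using (angCLM a b).contDiff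

theorem continuous_ang (a b : Fin 4) : Continuous fun θ => ang θ a b :=
  (contDiff_ang a b (n := 0)).continuous

theorem continuous_angleSum (v : Fin 4) : Continuous fun θ => angleSum θ v := by
  simpa only [← angleSumCLM_apply] using (angleSumCLM v).continuous

theorem AllDistinct.angleSum_eq {a b c d : Fin 4} (h : AllDistinct a b c d) (θ : TetEdge → ℝ) :
    angleSum θ a = ang θ a b + ang θ a c + ang θ a d :=
  h.sum_erase _

theorem AllDistinct.dFun_eq {a b c d : Fin 4} (h : AllDistinct a b c d) (θ : TetEdge → ℝ) :
    dFun θ a = gram (cos (ang θ a b)) (cos (ang θ a c)) (cos (ang θ a d)) := by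
  have hprod := h.sum_erase (M := Additive ℝ) fun w => Additive.ofMul (cos (ang θ a w))
  have hprod' : ∏ w ∈ Finset.univ.erase a, cos (ang θ a w) =
    cos (ang θ a b) * cos (ang θ a c) * cos (ang θ a d) := hprod
  rw [dFun, hprod', h.sum_erase, gram]
  ring

end Angles

section Tetrahedron

open Real

/-- The hyperbolic cosine of the length of the internal edge `ab`, given the dihedral angles. -/
def coshLength (θ : TetEdge → ℝ) (a b : Fin 4) : ℝ :=
  cFun θ a b (rest a b).1 (rest a b).2 / √(dFun θ a * dFun θ b)

/-- The hyperbolic cosine of the length of the boundary edge at `a` joining the internal edges `ax`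
and `ay`, where `z` is the remaining vertex, given the dihedral angles. -/
def coshBdry (θ : TetEdge → ℝ) (a x y z : Fin 4) : ℝ :=
  cosineRule (cos (ang θ a x)) (cos (ang θ a y)) (cos (ang θ a z))

/-- The angles `θ` are those of a partially truncated tetrahedron with set of ideal vertices
`I`. -/
structure IsGeometric (I : Set (Fin 4)) (θ : TetEdge → ℝ) : Prop where
  mem_Ioo : ∀ a b, a ≠ b → ang θ a b ∈ Set.Ioo 0 π
  angleSum_eq : ∀ v ∈ I, angleSum θ v = π
  angleSum_lt : ∀ v ∉ I, angleSum θ v < π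

/-- A neighbourhood, in the space of all angle assignments, of those which are realized by partially
truncated tetrahedra with set of ideal vertices `I`; the formulas for the lengths of the edges and
for the invariants `σ` keep their meaning there.  The last condition bounds the hyperbolic cosines
of all boundary edges from below by `-1`. -/
structure IsAdmissible (I : Set (Fin 4)) (θ : TetEdge → ℝ) : Prop where
  mem_Ioo : ∀ a b, a ≠ b → ang θ a b ∈ Set.Ioo 0 π
  angleSum_lt : ∀ v ∉ I, angleSum θ v < π
  angleSum_lt_add : ∀ v w, v ≠ w → angleSum θ v < π + 2 * ang θ v w

variable {I : Set (Fin 4)} {θ : TetEdge → ℝ} {a b c d i v : Fin 4}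

theorem IsGeometric.isAdmissible (hθ : IsGeometric I θ) : IsAdmissible I θ where
  mem_Ioo := hθ.mem_Ioo
  angleSum_lt := hθ.angleSum_lt
  angleSum_lt_add v w hvw := by
    have hle : angleSum θ v ≤ π := by
      by_cases hv : v ∈ I
      exacts [(hθ.angleSum_eq v hv).le, (hθ.angleSum_lt v hv).le]
    linarith [(hθ.mem_Ioo v w hvw).1]

theorem isOpen_setOf_isAdmissible (I : Set (Fin 4)) : IsOpen {θ | IsAdmissible I θ} := by
  have hset : {θ | IsAdmissible I θ} =
      (⋂ a, ⋂ b, ⋂ _ : a ≠ b, {θ | ang θ a b ∈ Set.Ioo 0 π}) ∩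
      (⋂ v, ⋂ _ : v ∉ I, {θ | angleSum θ v < π}) ∩
      ⋂ v, ⋂ w, ⋂ _ : v ≠ w, {θ | angleSum θ v < π + 2 * ang θ v w} := by
    ext θ
    simp only [Set.mem_inter_iff, Set.mem_iInter, Set.mem_ofPred_eq]
    exact ⟨fun h => ⟨⟨h.1, h.2⟩, h.3⟩, fun h => ⟨h.1.1, h.1.2, h.2⟩⟩
  rw [hset]
  refine IsOpen.inter (IsOpen.inter ?_ ?_) ?_ <;>
    repeat' refine isOpen_iInter_of_finite fun _ => ?_
  · exact isOpen_Ioo.preimage (continuous_ang _ _)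
  · exact isOpen_lt (continuous_angleSum _) continuous_const
  · exact isOpen_lt (continuous_angleSum _) (((continuous_ang _ _).const_mul 2).const_add π)

theorem cFun_swap (θ : TetEdge → ℝ) (a b c d : Fin 4) : cFun θ a b c d = cFun θ a b d c := by
  unfold cFun
  rw [ang_comm θ d c]
  ring

theorem coshLength_eq (h : AllDistinct a b c d) (θ : TetEdge → ℝ) :
    coshLength θ a b = cFun θ a b c d / √(dFun θ a * dFun θ b) := by
  unfold coshLength
  rcases rest_eq_or_eq h with hrest | hrest <;> rw [hrest]
  rw [cFun_swap]

theorem coshBdry_comm (θ : TetEdge → ℝ) (a x y z : Fin 4) :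
    coshBdry θ a x y z = coshBdry θ a y x z :=
  cosineRule_comm _ _ _

namespace IsAdmissible

theorem sin_ang_pos (hθ : IsAdmissible I θ) (h : a ≠ b) : 0 < sin (ang θ a b) :=
  sin_pos_of_mem_Ioo (hθ.mem_Ioo a b h)

theorem ang_add_ang_add_ang_lt (hθ : IsAdmissible I θ) (h : AllDistinct a b c d) (ha : a ∉ I) :
    ang θ a b + ang θ a c + ang θ a d < π :=
  h.angleSum_eq θ ▸ hθ.angleSum_lt a ha

theorem ang_add_ang_lt (hθ : IsAdmissible I θ) (h : AllDistinct a b c d) :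
    ang θ a b + ang θ a c < π + ang θ a d := by
  have hlt := hθ.angleSum_lt_add a d h.2.2.1
  rw [h.angleSum_eq] at hlt
  linarith

theorem dFun_pos (hθ : IsAdmissible I θ) (ha : a ∉ I) : 0 < dFun θ a := by
  obtain ⟨b, hb⟩ := exists_ne a
  obtain ⟨c, d, h⟩ := exists_allDistinct hb.symm
  rw [h.dFun_eq]
  exact gram_cos_pos (hθ.mem_Ioo a b h.1) (hθ.mem_Ioo a c h.2.1) (hθ.mem_Ioo a d h.2.2.1).1
    (hθ.ang_add_ang_add_ang_lt h ha)

theorem coshBdry_eq (hθ : IsAdmissible I θ) (h : AllDistinct a b c d) :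
    coshBdry θ a b c d = (cos (ang θ a b) * cos (ang θ a c) + cos (ang θ a d)) /
      (sin (ang θ a b) * sin (ang θ a c)) := by
  rw [coshBdry, cosineRule, sqrt_cos_sq_sub_one_mul (hθ.mem_Ioo a b h.1) (hθ.mem_Ioo a c h.2.1)]

theorem boundaryLength_eq (hθ : IsAdmissible I θ) (h : AllDistinct a b c d) :
    boundaryLength θ a b c d = arcosh (coshBdry θ a b c d) := by
  rw [hθ.coshBdry_eq h, boundaryLength]

theorem neg_one_lt_coshBdry (hθ : IsAdmissible I θ) (h : AllDistinct a b c d) :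
    -1 < coshBdry θ a b c d :=
  neg_one_lt_cosineRule_cos (hθ.mem_Ioo a b h.1) (hθ.mem_Ioo a c h.2.1) (hθ.mem_Ioo a d h.2.2.1)
    (hθ.ang_add_ang_lt h.swap₃₄) (hθ.ang_add_ang_lt h.swap₂₃.swap₃₄)

theorem one_lt_coshBdry (hθ : IsAdmissible I θ) (h : AllDistinct a b c d) (ha : a ∉ I) :
    1 < coshBdry θ a b c d :=
  one_lt_cosineRule_cos (hθ.mem_Ioo a b h.1) (hθ.mem_Ioo a c h.2.1) (hθ.mem_Ioo a d h.2.2.1).1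
    (hθ.ang_add_ang_add_ang_lt h ha)

theorem coshBdry_sq_sub_one (hθ : IsAdmissible I θ) (h : AllDistinct a b c d) :
    coshBdry θ a b c d ^ 2 - 1 = dFun θ a / (sin (ang θ a b) * sin (ang θ a c)) ^ 2 := by
  have hpos := cos_sq_sub_one_mul_pos (hθ.mem_Ioo a b h.1) (hθ.mem_Ioo a c h.2.1)
  rw [coshBdry, cosineRule_sq_sub_one hpos, ← h.dFun_eq, ← sq_sqrt hpos.le,
    sqrt_cos_sq_sub_one_mul (hθ.mem_Ioo a b h.1) (hθ.mem_Ioo a c h.2.1)]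

theorem sqrt_coshBdry_sq_sub_one (hθ : IsAdmissible I θ) (h : AllDistinct a b c d) :
    √(coshBdry θ a b c d ^ 2 - 1) = √(dFun θ a) / (sin (ang θ a b) * sin (ang θ a c)) := by
  have hpos := mul_pos (hθ.sin_ang_pos h.1) (hθ.sin_ang_pos h.2.1)
  rw [hθ.coshBdry_sq_sub_one h, sqrt_div' _ (sq_nonneg _), sqrt_sq hpos.le]

theorem coshLength_eq_cosineRule (hθ : IsAdmissible I θ) (h : AllDistinct a b c d) :
    coshLength θ a b =
      cosineRule (coshBdry θ a b c d) (coshBdry θ b a c d) (coshBdry θ c a b d) := by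
  have hab := hθ.sin_ang_pos h.1
  have hac := hθ.sin_ang_pos h.2.1
  have hbc := hθ.sin_ang_pos h.swap₁₂.2.1
  have hsqrt : √((coshBdry θ a b c d ^ 2 - 1) * (coshBdry θ b a c d ^ 2 - 1)) =
      √(dFun θ a * dFun θ b) / (sin (ang θ a b) ^ 2 * sin (ang θ a c) * sin (ang θ b c)) := by
    rw [hθ.coshBdry_sq_sub_one h, hθ.coshBdry_sq_sub_one h.swap₁₂, div_mul_div_comm, ← mul_pow,
      sqrt_div' _ (sq_nonneg _), ang_comm θ b a, sqrt_sq (by positivity)]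
    ring
  have hnumer : coshBdry θ a b c d * coshBdry θ b a c d + coshBdry θ c a b d =
      cFun θ a b c d / (sin (ang θ a b) ^ 2 * sin (ang θ a c) * sin (ang θ b c)) := by
    rw [hθ.coshBdry_eq h, hθ.coshBdry_eq h.swap₁₂, hθ.coshBdry_eq h.swap₂₃.swap₁₂, cFun,
      ang_comm θ b a, ang_comm θ c a, ang_comm θ c b]
    have hsq := sin_sq (ang θ a b)
    generalize sin (ang θ a b) = s at *
    field_simp
    rw [hsq]
    ring
  rw [coshLength_eq h, cosineRule, hsqrt, hnumer, div_div_div_cancel_right₀ (by positivity)]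

theorem one_lt_coshLength (hθ : IsAdmissible I θ) (h : a ≠ b) (ha : a ∉ I) (hb : b ∉ I) :
    1 < coshLength θ a b := by
  obtain ⟨c, d, h⟩ := exists_allDistinct h
  rw [hθ.coshLength_eq_cosineRule h]
  exact one_lt_cosineRule (hθ.one_lt_coshBdry h ha) (hθ.one_lt_coshBdry h.swap₁₂ hb)
    (hθ.neg_one_lt_coshBdry h.swap₂₃.swap₁₂)

theorem sinh_boundaryLength (hθ : IsAdmissible I θ) (h : AllDistinct a b c d) (ha : a ∉ I) :
    sinh (boundaryLength θ a b c d) = √(coshBdry θ a b c d ^ 2 - 1) := by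
  rw [hθ.boundaryLength_eq h, sinh_arcosh (hθ.one_lt_coshBdry h ha).le]

theorem sinh_boundaryLength_pos (hθ : IsAdmissible I θ) (h : AllDistinct a b c d) (ha : a ∉ I) :
    0 < sinh (boundaryLength θ a b c d) := by
  rw [hθ.sinh_boundaryLength h ha]
  exact sqrt_pos.2 (sq_sub_one_pos (hθ.one_lt_coshBdry h ha))

theorem sigmaAt_eq (hI : I.Subsingleton) (hθ : IsAdmissible I θ) (hv : v ∈ I) (hi : i ≠ v) :
    sigmaAt θ i v = log (√(dFun θ (rest i v).1) / sin (ang θ (rest i v).1 v)) -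
      log (√(dFun θ (rest i v).2) / sin (ang θ (rest i v).2 v)) := by
  have h := allDistinct_rest hi
  unfold sigmaAt
  generalize (rest i v).1 = a at *
  generalize (rest i v).2 = b at *
  have ha : a ∉ I := fun ha => h.2.2.2.1 (hI hv ha)
  have hb : b ∉ I := fun hb => h.2.2.2.2.1 (hI hv hb)
  have ha_lab : AllDistinct a v b i := h.swap₁₂.swap₂₃.swap₁₂.swap₃₄
  have hb_lab : AllDistinct b v a i := ha_lab.swap₂₃.swap₁₂.swap₂₃
  rw [hθ.sinh_boundaryLength ha_lab ha, hθ.sinh_boundaryLength hb_lab hb,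
    hθ.sqrt_coshBdry_sq_sub_one ha_lab, hθ.sqrt_coshBdry_sq_sub_one hb_lab, ang_comm θ b a]
  have := hθ.sin_ang_pos ha_lab.1
  have := hθ.sin_ang_pos hb_lab.1
  have := hθ.sin_ang_pos ha_lab.2.1
  have := sqrt_pos.2 (hθ.dFun_pos ha)
  have := sqrt_pos.2 (hθ.dFun_pos hb)
  rw [← log_div (by positivity) (by positivity)]
  field_simp

theorem sum_sigmaAt (hI : I.Subsingleton) (hθ : IsAdmissible I θ) (hv : v ∈ I) :
    ∑ i ∈ Finset.univ.erase v, sigmaAt θ i v = 0 := by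
  rw [← sum_sub_rest (fun a => log (√(dFun θ a) / sin (ang θ a v))) v]
  exact Finset.sum_congr rfl fun i hi => hθ.sigmaAt_eq hI hv (Finset.ne_of_mem_erase hi)

theorem eventually_nhds (hθ : IsAdmissible I θ) : ∀ᶠ η in 𝓝 θ, IsAdmissible I η :=
  (isOpen_setOf_isAdmissible I).mem_nhds hθ

theorem contDiffAt_coshLength (hθ : IsAdmissible I θ) (ha : a ∉ I) (hb : b ∉ I)
    {n : ℕ∞ω} : ContDiffAt ℝ n (fun η => coshLength η a b) θ := by
  have hpos := mul_pos (hθ.dFun_pos ha) (hθ.dFun_pos hb)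
  have hsqrt := (sqrt_pos.2 hpos).ne'
  unfold coshLength dFun cFun at *
  fun_prop (disch := first | assumption | exact hpos.ne')

theorem contDiffAt_edgeLength (hθ : IsAdmissible I θ) {e : TetEdge} (he : ∀ v ∈ e.1, v ∉ I)
    {n : ℕ∞ω} : ContDiffAt ℝ n (fun η => edgeLength η e) θ := by
  obtain ⟨a, b, h, rfl⟩ := e.exists_eq_mk
  have ha : a ∉ I := he a (Sym2.mem_mk_left a b)
  have hb : b ∉ I := he b (Sym2.mem_mk_right a b)
  exact (contDiffAt_arcosh (hθ.one_lt_coshLength h ha hb)).comp θ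
    (hθ.contDiffAt_coshLength ha hb)

theorem contDiffAt_log_sqrt_dFun_div (hθ : IsAdmissible I θ) (h : a ≠ b) (ha : a ∉ I) {n : ℕ∞ω} :
    ContDiffAt ℝ n (fun η => log (√(dFun η a) / sin (ang η a b))) θ := by
  have hsin := (hθ.sin_ang_pos h).ne'
  have hpos := hθ.dFun_pos ha
  have hdiv := div_ne_zero (sqrt_pos.2 hpos).ne' hsin
  unfold dFun at *
  fun_prop (disch := first | assumption | exact hpos.ne')

theorem contDiffAt_sigmaAt (hI : I.Subsingleton) (hθ : IsAdmissible I θ) (hv : v ∈ I) (hi : i ≠ v)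
    {n : ℕ∞ω} : ContDiffAt ℝ n (fun η => sigmaAt η i v) θ := by
  obtain ⟨-, -, -, ha, hb, -⟩ := allDistinct_rest hi
  refine ((hθ.contDiffAt_log_sqrt_dFun_div ha.symm (fun h => ha (hI hv h))).sub
    (hθ.contDiffAt_log_sqrt_dFun_div hb.symm (fun h => hb (hI hv h)))).congr_of_eventuallyEq ?_
  filter_upwards [hθ.eventually_nhds] with η hη using hη.sigmaAt_eq hI hv hi

end IsAdmissible

end Tetrahedron

section InfinitesimalRigidity

open Real

/-- To first order, the direction `ξ` preserves the sums of the angles at the ideal vertices, the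
lengths of the edges without ideal endpoints and the invariants `σ` of a tetrahedron with set of
ideal vertices `I`. -/
structure IsIsometricDirection (I : Set (Fin 4)) (θ ξ : TetEdge → ℝ) : Prop where
  angleSum_eq_zero : ∀ v ∈ I, angleSum ξ v = 0
  edgeLength : ∀ e : TetEdge, (∀ v ∈ e.1, v ∉ I) →
    HasLineDerivAt ℝ (fun η => edgeLength η e) 0 θ ξ
  sigmaAt : ∀ i v, i ≠ v → v ∈ I → HasLineDerivAt ℝ (fun η => sigmaAt η i v) 0 θ ξ

variable {I : Set (Fin 4)} {θ ξ : TetEdge → ℝ} {a b c d : Fin 4}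

theorem IsGeometric.coshBdry_eq_one (hθ : IsGeometric I θ) (h : AllDistinct a b c d) (ha : a ∈ I) :
    coshBdry θ a b c d = 1 :=
  cosineRule_cos_eq_one (hθ.mem_Ioo a b h.1) (hθ.mem_Ioo a c h.2.1)
    (h.angleSum_eq θ ▸ hθ.angleSum_eq a ha)

namespace IsIsometricDirection

theorem eventually_isGeometric (hξ : IsIsometricDirection I θ ξ) (hθ : IsGeometric I θ) :
    ∀ᶠ s : ℝ in 𝓝 0, IsGeometric I (θ + s • ξ) := by
  have hline : Tendsto (fun s : ℝ => θ + s • ξ) (𝓝 0) (𝓝 θ) := by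
    have : Continuous fun s : ℝ => θ + s • ξ := by fun_prop
    simpa using this.tendsto 0
  filter_upwards [hline.eventually hθ.isAdmissible.eventually_nhds] with s hs
  refine ⟨hs.mem_Ioo, fun v hv => ?_, hs.angleSum_lt⟩
  rw [angleSum_add_smul, hξ.angleSum_eq_zero v hv, hθ.angleSum_eq v hv, mul_zero, add_zero]

theorem coshLength (hξ : IsIsometricDirection I θ ξ) (hθ : IsAdmissible I θ) (h : a ≠ b)
    (ha : a ∉ I) (hb : b ∉ I) : HasLineDerivAt ℝ (fun η => coshLength η a b) 0 θ ξ := by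
  have he : ∀ v ∈ s(a, b), v ∉ I := by
    intro v hv
    rcases Sym2.mem_iff.1 hv with rfl | rfl <;> assumption
  refine hasLineDerivAt_zero_of_comp_eventuallyEq (Φ := cosh)
    (hξ.edgeLength ⟨s(a, b), mt Sym2.mk_isDiag_iff.mp h⟩ he) differentiableAt_cosh ?_
  filter_upwards [hθ.eventually_nhds] with η hη
  exact cosh_arcosh (hη.one_lt_coshLength h ha hb).le

theorem cosineRule_coshBdry (hξ : IsIsometricDirection I θ ξ) (hθ : IsAdmissible I θ)
    (h : AllDistinct a b c d) (ha : a ∉ I) (hb : b ∉ I) :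
    HasLineDerivAt ℝ (fun η => cosineRule (coshBdry η a b c d) (coshBdry η b a c d)
      (coshBdry η c a b d)) 0 θ ξ := by
  refine (hξ.coshLength hθ h.1 ha hb).congr_of_eventuallyEq ?_
  filter_upwards [hθ.eventually_nhds] with η hη using (hη.coshLength_eq_cosineRule h).symm

theorem sqrt_coshBdry_div (hξ : IsIsometricDirection I θ ξ) (hθ : IsAdmissible I θ)
    (h : AllDistinct a b c d) (ha : a ∉ I) (hb : b ∉ I) (hc : c ∈ I) :
    HasLineDerivAt ℝ (fun η => √(coshBdry η a c b d ^ 2 - 1) / √(coshBdry η b c a d ^ 2 - 1))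
      0 θ ξ := by
  have hacbd := h.swap₂₃
  have hbcad := h.swap₁₂.swap₂₃
  have hsigma := hξ.sigmaAt d c h.2.2.2.2.2.symm hc
  have hdcab : AllDistinct d c a b := h.swap₂₃.swap₁₂.swap₃₄.swap₂₃.swap₁₂
  unfold TruncTri.sigmaAt at hsigma
  rcases rest_eq_or_eq hdcab with hrest | hrest <;> simp only [hrest] at hsigma
  · refine hasLineDerivAt_zero_of_comp_eventuallyEq (Φ := exp) hsigma differentiableAt_exp ?_
    filter_upwards [hθ.eventually_nhds] with η hη
    rw [exp_log (div_pos (hη.sinh_boundaryLength_pos hacbd ha)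
      (hη.sinh_boundaryLength_pos hbcad hb)), hη.sinh_boundaryLength hacbd ha,
      hη.sinh_boundaryLength hbcad hb]
  · refine hasLineDerivAt_zero_of_comp_eventuallyEq (Φ := fun t => exp (-t)) hsigma
      (by fun_prop) ?_
    filter_upwards [hθ.eventually_nhds] with η hη
    rw [exp_neg, exp_log (div_pos (hη.sinh_boundaryLength_pos hbcad hb)
      (hη.sinh_boundaryLength_pos hacbd ha)), inv_div, hη.sinh_boundaryLength hacbd ha,
      hη.sinh_boundaryLength hbcad hb]

theorem coshBdry_of_mem (hξ : IsIsometricDirection I θ ξ) (hI : I.Subsingleton)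
    (hθ : IsGeometric I θ) (h : AllDistinct a b c d) (hc : c ∈ I) :
    HasLineDerivAt ℝ (fun η => coshBdry η a b c d) 0 θ ξ := by
  have ha : a ∉ I := fun ha => h.2.1 (hI ha hc)
  have hb : b ∉ I := fun hb => h.2.2.2.1 (hI hb hc)
  have hadm := hθ.isAdmissible
  refine hasLineDerivAt_zero_of_pentagon (g := fun η => coshBdry η b a c d) ?_ ?_ ?_ ?_
  · filter_upwards [hadm.eventually_nhds] with η hη using hη.one_lt_coshBdry h ha
  · filter_upwards [hadm.eventually_nhds] with η hη using hη.one_lt_coshBdry h.swap₁₂ hb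
  · refine HasDerivAt.congr_of_eventuallyEq (hξ.cosineRule_coshBdry hadm h ha hb) ?_
    filter_upwards [hξ.eventually_isGeometric hθ] with s hs
    rw [hs.coshBdry_eq_one h.swap₂₃.swap₁₂ hc]
  · simp only [coshBdry_comm _ _ _ c]
    exact hξ.sqrt_coshBdry_div hadm h ha hb hc

theorem coshBdry (hξ : IsIsometricDirection I θ ξ) (hI : I.Subsingleton) (hθ : IsGeometric I θ)
    (h : AllDistinct a b c d) (ha : a ∉ I) :
    HasLineDerivAt ℝ (fun η => coshBdry η a b c d) 0 θ ξ := by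
  by_cases hc : c ∈ I
  · exact hξ.coshBdry_of_mem hI hθ h hc
  by_cases hb : b ∈ I
  · simp only [coshBdry_comm _ a b c]
    exact hξ.coshBdry_of_mem hI hθ h.swap₂₃ hb
  have hadm := hθ.isAdmissible
  have hacb := hξ.cosineRule_coshBdry hadm h.swap₂₃ ha hc
  have hbca := hξ.cosineRule_coshBdry hadm h.swap₁₂.swap₂₃ hb hc
  simp only [coshBdry_comm _ a c b] at hacb
  simp only [coshBdry_comm _ b c a, coshBdry_comm _ c b a] at hbca
  refine hasLineDerivAt_zero_of_hexagon ?_ ?_ ?_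
    (hξ.cosineRule_coshBdry hadm h ha hb) hacb hbca <;>
    filter_upwards [hadm.eventually_nhds] with η hη
  exacts [hη.one_lt_coshBdry h ha, hη.one_lt_coshBdry h.swap₁₂ hb,
    hη.one_lt_coshBdry h.swap₂₃.swap₁₂ hc]

theorem cos_ang (hξ : IsIsometricDirection I θ ξ) (hI : I.Subsingleton) (hθ : IsGeometric I θ)
    (h : a ≠ b) (ha : a ∉ I) : HasLineDerivAt ℝ (fun η => cos (ang η a b)) 0 θ ξ := by
  obtain ⟨c, d, h⟩ := exists_allDistinct h
  have hadm := hθ.isAdmissible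
  refine hasLineDerivAt_zero_cos_of_triangle ?_ ?_ ?_ ?_ (hξ.coshBdry hI hθ h ha)
    (hξ.coshBdry hI hθ h.swap₃₄ ha) (hξ.coshBdry hI hθ h.swap₂₃.swap₃₄ ha) <;>
    filter_upwards [hadm.eventually_nhds] with η hη
  exacts [hη.mem_Ioo a b h.1, hη.mem_Ioo a c h.2.1, hη.mem_Ioo a d h.2.2.1,
    hη.ang_add_ang_add_ang_lt h ha]

theorem ang_eq_zero (hξ : IsIsometricDirection I θ ξ) (hI : I.Subsingleton)
    (hθ : IsGeometric I θ) (h : a ≠ b) (ha : a ∉ I) : ang ξ a b = 0 := by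
  have hderiv : HasLineDerivAt ℝ (fun η => cos (ang η a b)) (-sin (ang θ a b) * ang ξ a b) θ ξ := by
    have := ((angCLM a b).hasFDerivAt (x := θ)).cos.hasLineDerivAt ξ
    simpa only [angCLM_apply, smul_apply, smul_eq_mul] using this
  have hzero := hderiv.unique (hξ.cos_ang hI hθ h ha)
  simpa [(hθ.isAdmissible.sin_ang_pos h).ne'] using hzero

theorem eq_zero (hξ : IsIsometricDirection I θ ξ) (hI : I.Subsingleton) (hθ : IsGeometric I θ) :
    ξ = 0 := by
  funext e
  obtain ⟨a, b, h, rfl⟩ := e.exists_eq_mk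
  rw [← ang_of_ne h ξ, Pi.zero_apply]
  by_cases ha : a ∈ I
  · rw [ang_comm]
    exact hξ.ang_eq_zero hI hθ h.symm fun hb => h (hI ha hb)
  · exact hξ.ang_eq_zero hI hθ h ha

end IsIsometricDirection

end InfinitesimalRigidity

section Surjectivity

variable {I : Set (Fin 4)} {θ ξ : TetEdge → ℝ} {i v : Fin 4}

theorem IsAdmissible.hasFDerivAt_edgeLength (hθ : IsAdmissible I θ) {e : TetEdge}
    (he : ∀ v ∈ e.1, v ∉ I) :
    HasFDerivAt (fun η => edgeLength η e) (fderiv ℝ (fun η => edgeLength η e) θ) θ :=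
  ((hθ.contDiffAt_edgeLength he).differentiableAt one_ne_zero).hasFDerivAt

theorem IsAdmissible.hasFDerivAt_sigmaAt (hI : I.Subsingleton) (hθ : IsAdmissible I θ) (hv : v ∈ I)
    (hi : i ≠ v) :
    HasFDerivAt (fun η => sigmaAt η i v) (fderiv ℝ (fun η => sigmaAt η i v) θ) θ :=
  ((hθ.contDiffAt_sigmaAt hI hv hi).differentiableAt one_ne_zero).hasFDerivAt

theorem IsAdmissible.sum_fderiv_sigmaAt (hI : I.Subsingleton) (hθ : IsAdmissible I θ) (hv : v ∈ I)
    (ξ : TetEdge → ℝ) :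
    ∑ i ∈ Finset.univ.erase v, fderiv ℝ (fun η => sigmaAt η i v) θ ξ = 0 := by
  have hsum := HasFDerivAt.fun_sum fun i (hi : i ∈ Finset.univ.erase v) =>
    hθ.hasFDerivAt_sigmaAt hI hv (Finset.ne_of_mem_erase hi)
  have hzero : HasFDerivAt (fun η => ∑ i ∈ Finset.univ.erase v, sigmaAt η i v)
      (0 : (TetEdge → ℝ) →L[ℝ] ℝ) θ := by
    refine (hasFDerivAt_const (0 : ℝ) θ).congr_of_eventuallyEq ?_
    filter_upwards [hθ.eventually_nhds] with η hη using hη.sum_sigmaAt hI hv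
  simpa using congrArg (· ξ) (hsum.unique hzero)

/-- Indices for a system of local coordinates on the angle assignments of a tetrahedron with set of
ideal vertices `I`: its edges without ideal endpoints, and its pairs formed by a face `i` and an
ideal vertex `v` of this face. -/
abbrev TetCoord (I : Set (Fin 4)) : Type :=
  {e : TetEdge // ∀ v ∈ e.1, v ∉ I} ⊕ {x : Fin 4 × Fin 4 // x.1 ≠ x.2 ∧ x.2 ∈ I}

theorem natCard_tetCoord (hI : I.Subsingleton) : Nat.card (TetCoord I) = Nat.card TetEdge := by
  rcases hI.eq_empty_or_singleton with rfl | ⟨v, rfl⟩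
  · simp
  · simp only [Nat.card_eq_fintype_card]
    revert v
    decide

/-- The differential at `θ` of the lengths and of the invariants `σ`, to which the sum of the
angles at the ideal vertex is added in order to compensate for the vanishing of the sum of the
`σ`. -/
def tetDifferential (I : Set (Fin 4)) (θ : TetEdge → ℝ) :
    (TetEdge → ℝ) →ₗ[ℝ] (TetCoord I → ℝ) :=
  LinearMap.pi <| Sum.elim
    (fun e => (fderiv ℝ (fun η => edgeLength η e.1) θ).toLinearMap)
    fun x => (fderiv ℝ (fun η => sigmaAt η x.1.1 x.1.2) θ + angleSumCLM x.1.2).toLinearMap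

theorem tetDifferential_inl (e : {e : TetEdge // ∀ v ∈ e.1, v ∉ I}) :
    tetDifferential I θ ξ (Sum.inl e) = fderiv ℝ (fun η => edgeLength η e.1) θ ξ := rfl

theorem tetDifferential_inr (x : {x : Fin 4 × Fin 4 // x.1 ≠ x.2 ∧ x.2 ∈ I}) :
    tetDifferential I θ ξ (Sum.inr x) =
      fderiv ℝ (fun η => sigmaAt η x.1.1 x.1.2) θ ξ + angleSum ξ x.1.2 := by
  simp [tetDifferential]

theorem IsAdmissible.angleSum_eq_of_tetDifferential (hI : I.Subsingleton) (hθ : IsAdmissible I θ)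
    (hv : v ∈ I) {τ : Fin 4 → ℝ} (hτ : ∑ i ∈ Finset.univ.erase v, τ i = 0) {m : ℝ}
    (h : ∀ i (hi : i ≠ v), tetDifferential I θ ξ (Sum.inr ⟨(i, v), hi, hv⟩) = τ i + m) :
    angleSum ξ v = m := by
  have hsum : ∑ i ∈ Finset.univ.erase v, (fderiv ℝ (fun η => sigmaAt η i v) θ ξ + angleSum ξ v) =
      ∑ i ∈ Finset.univ.erase v, (τ i + m) :=
    Finset.sum_congr rfl fun i hi => by
      rw [← h i (Finset.ne_of_mem_erase hi), tetDifferential_inr]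
  rw [Finset.sum_add_distrib, Finset.sum_add_distrib, hθ.sum_fderiv_sigmaAt hI hv, hτ] at hsum
  simpa using hsum

theorem IsGeometric.tetDifferential_injective (hI : I.Subsingleton) (hθ : IsGeometric I θ) :
    Function.Injective (tetDifferential I θ) := by
  have hadm := hθ.isAdmissible
  refine (injective_iff_map_eq_zero _).2 fun ξ hξ => ?_
  have hsum : ∀ v ∈ I, angleSum ξ v = 0 := fun v hv =>
    hadm.angleSum_eq_of_tetDifferential hI hv (τ := 0) (by simp) fun i hi => by simp [hξ]
  refine IsIsometricDirection.eq_zero ⟨hsum, fun e he => ?_, fun i v hi hv => ?_⟩ hI hθ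
  · have := (hadm.hasFDerivAt_edgeLength he).hasLineDerivAt ξ
    rwa [← tetDifferential_inl ⟨e, he⟩, hξ] at this
  · have := (hadm.hasFDerivAt_sigmaAt hI hv hi).hasLineDerivAt ξ
    rwa [← add_zero (fderiv ℝ _ θ ξ), ← hsum v hv, ← tetDifferential_inr ⟨(i, v), hi, hv⟩, hξ]
      at this

theorem IsGeometric.tetDifferential_surjective (hI : I.Subsingleton) (hθ : IsGeometric I θ) :
    Function.Surjective (tetDifferential I θ) := by
  have := Fintype.ofFinite (TetCoord I)
  refine (LinearMap.injective_iff_surjective_of_finrank_eq_finrank ?_).1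
    (hθ.tetDifferential_injective hI)
  rw [Module.finrank_fintype_fun_eq_card, Module.finrank_fintype_fun_eq_card,
    ← Nat.card_eq_fintype_card, ← Nat.card_eq_fintype_card, natCard_tetCoord hI]

theorem IsGeometric.exists_fderiv_eq (hI : I.Subsingleton) (hθ : IsGeometric I θ)
    (l : TetEdge → ℝ) (τ : Fin 4 → ℝ) (m : ℝ)
    (hτ : ∀ v ∈ I, ∑ i ∈ Finset.univ.erase v, τ i = 0) :
    ∃ ξ : TetEdge → ℝ, (∀ v ∈ I, angleSum ξ v = m) ∧
      (∀ e : TetEdge, (∀ v ∈ e.1, v ∉ I) → fderiv ℝ (fun η => edgeLength η e) θ ξ = l e) ∧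
      (∀ i v, i ≠ v → v ∈ I → fderiv ℝ (fun η => sigmaAt η i v) θ ξ = τ i) := by
  obtain ⟨ξ, hξ⟩ := hθ.tetDifferential_surjective hI
    (Sum.elim (fun e => l e.1) fun x => τ x.1.1 + m)
  have hsum : ∀ v ∈ I, angleSum ξ v = m := fun v hv =>
    hθ.isAdmissible.angleSum_eq_of_tetDifferential hI hv (hτ v hv) fun i hi => by rw [hξ]; rfl
  refine ⟨ξ, hsum, fun e he => ?_, fun i v hi hv => ?_⟩
  · rw [← tetDifferential_inl ⟨e, he⟩, hξ, Sum.elim_inl]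
  · have := tetDifferential_inr (θ := θ) (ξ := ξ) ⟨(i, v), hi, hv⟩
    rw [hξ, hsum v hv, Sum.elim_inr] at this
    exact (add_right_cancel this).symm

end Surjectivity

section RegularLevelSets

theorem exists_linearEquiv_prod_of_surjective {K V W X : Type*} [DivisionRing K] [AddCommGroup V]
    [AddCommGroup W] [AddCommGroup X] [Module K V] [Module K W] [Module K X]
    [FiniteDimensional K V] [FiniteDimensional K X] {f : V →ₗ[K] W} (hf : Function.Surjective f)
    (hrank : Module.finrank K V = Module.finrank K X + Module.finrank K W) :
    ∃ (g : V →ₗ[K] X) (e : V ≃ₗ[K] X × W), e.toLinearMap = g.prod f := by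
  have hker : Module.finrank K f.ker = Module.finrank K X := by
    have := f.finrank_range_add_finrank_ker
    rw [LinearMap.range_eq_top.2 hf, finrank_top] at this
    lia
  obtain ⟨p, hp⟩ := f.ker.subtype.exists_leftInverse_of_injective f.ker.ker_subtype
  have hp_apply : ∀ x : f.ker, p x = x := LinearMap.congr_fun hp
  have hcompl : IsCompl p.ker f.ker := (LinearMap.isCompl_of_proj hp_apply).symm
  have hp_range : p.range = ⊤ := LinearMap.range_eq_top.2 fun x => ⟨x, hp_apply x⟩
  let e := p.equivProdOfSurjectiveOfIsCompl f hp_range (LinearMap.range_eq_top.2 hf) hcompl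
  let g := LinearEquiv.ofFinrankEq f.ker X hker
  exact ⟨g.toLinearMap ∘ₗ p, e.trans (g.prodCongr (LinearEquiv.refl K W)), rfl⟩

theorem exists_openPartialHomeomorph_contDiffOn {𝕜 E F : Type*} [RCLike 𝕜]
    [NormedAddCommGroup E] [NormedSpace 𝕜 E] [CompleteSpace E]
    [NormedAddCommGroup F] [NormedSpace 𝕜 F] {f : E → F} {U : Set E} {n : ℕ∞ω}
    (hU : IsOpen U) (hf : ContDiffOn 𝕜 n f U) (hn : n ≠ 0) {a : E} (ha : a ∈ U) {f' : E ≃L[𝕜] F}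
    (hf' : HasFDerivAt f (f' : E →L[𝕜] F) a) :
    ∃ φ : OpenPartialHomeomorph E F,
      ⇑φ = f ∧ a ∈ φ.source ∧ φ.source ⊆ U ∧ ContDiffOn 𝕜 n φ.symm φ.target := by
  have hfU : ∀ x ∈ U, ContDiffAt 𝕜 n f x := fun x hx => hf.contDiffAt (hU.mem_nhds hx)
  let V := U ∩ fderiv 𝕜 f ⁻¹' Set.range ((↑) : (E ≃L[𝕜] F) → E →L[𝕜] F)
  have hV : IsOpen V := (hf.continuousOn_fderiv_of_isOpen hU
    (ENat.one_le_iff_ne_zero_withTop.2 hn)).isOpen_inter_preimage hU ContinuousLinearEquiv.isOpen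
  let φ := ((hfU a ha).toOpenPartialHomeomorph f hf' hn).restrOpen V hV
  refine ⟨φ, rfl, ⟨(hfU a ha).mem_toOpenPartialHomeomorph_source hf' hn, ha, f', hf'.fderiv.symm⟩,
    fun x hx => hx.2.1, fun y hy => ?_⟩
  obtain ⟨-, hyU, g, hg⟩ := φ.map_target hy
  have hderiv : HasFDerivAt f (g : E →L[𝕜] F) (φ.symm y) :=
    hg ▸ ((hfU _ hyU).differentiableAt hn).hasFDerivAt
  exact (φ.contDiffAt_symm hy hderiv (hfU _ hyU)).contDiffWithinAt

theorem isSmoothManifoldNear_of_surjective_fderiv {E F : Type*} [NormedAddCommGroup E]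
    [NormedSpace ℝ E] [FiniteDimensional ℝ E] [NormedAddCommGroup F] [NormedSpace ℝ F]
    [FiniteDimensional ℝ F] {f : E → F} {U S : Set E} (hU : IsOpen U) (hf : ContDiffOn ℝ ∞ f U)
    (hS : ∀ x ∈ U, x ∈ S ↔ f x = 0) {a : E} (haU : a ∈ U) (haS : a ∈ S)
    (hsurj : Function.Surjective (fderiv ℝ f a)) {n : ℕ}
    (hrank : Module.finrank ℝ E = n + Module.finrank ℝ F) : IsSmoothManifoldNear S n a := by
  have := FiniteDimensional.complete ℝ E
  let c : F ≃L[ℝ] (Fin (Module.finrank ℝ F) → ℝ) := ContinuousLinearEquiv.ofFinrankEq (by simp)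
  let f' := c.toContinuousLinearMap.comp (fderiv ℝ f a)
  obtain ⟨g, e, he⟩ := exists_linearEquiv_prod_of_surjective (X := Fin n → ℝ)
    (f := f'.toLinearMap) (c.surjective.comp hsurj) (by simpa using hrank)
  let A : E →L[ℝ] (Fin n → ℝ) := LinearMap.toContinuousLinearMap g
  have hf' : HasFDerivAt f (fderiv ℝ f a) a :=
    ((hf.contDiffAt (hU.mem_nhds haU)).differentiableAt (by simp)).hasFDerivAt
  have he' : (e.toContinuousLinearEquiv : E →L[ℝ] (Fin n → ℝ) × _) = A.prod f' :=
    ContinuousLinearMap.ext (LinearMap.congr_fun he)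
  have hderiv : HasFDerivAt (fun x => (A x, c (f x)))
      (e.toContinuousLinearEquiv : E →L[ℝ] (Fin n → ℝ) × _) a :=
    he' ▸ A.hasFDerivAt.prodMk (c.hasFDerivAt.comp a hf')
  have hsmooth : ContDiffOn ℝ ∞ (fun x => (A x, c (f x))) U :=
    A.contDiff.contDiffOn.prodMk (c.contDiff.comp_contDiffOn hf)
  obtain ⟨φ, hφ, haφ, hφU, hsymm⟩ :=
    exists_openPartialHomeomorph_contDiffOn hU hsmooth (by simp) haU hderiv
  refine ⟨haS, Module.finrank ℝ F, φ, haφ, hφ ▸ hsmooth.mono hφU, hsymm, fun x hx => ?_⟩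
  rw [hS x (hφU hx), hφ]
  exact c.map_eq_zero_iff.symm

end RegularLevelSets

section Counting

variable {α β : Type*}

theorem mk_apply_eq_mk_apply_iff {f : α → α} (hf : Function.Involutive f) {a b : α} :
    s(a, f a) = s(b, f b) ↔ a = b ∨ a = f b := by
  rw [Sym2.eq_iff]
  refine ⟨Or.imp And.left And.left, ?_⟩
  rintro (rfl | rfl)
  exacts [.inl ⟨rfl, rfl⟩, .inr ⟨rfl, hf b⟩]

theorem natCard_subtype_eq_two_mul [Finite α] {f : α → α} (hf : Function.Involutive f)
    (hne : ∀ a, f a ≠ a) {P : α → Prop} (hP : ∀ a, P a → P (f a)) :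
    Nat.card {a // P a} = 2 * Nat.card {q : Sym2 α // ∃ a, P a ∧ q = s(a, f a)} := by
  let orbit : {a // P a} → {q : Sym2 α // ∃ a, P a ∧ q = s(a, f a)} :=
    fun a => ⟨s(a.1, f a.1), a.1, a.2, rfl⟩
  have hfiber : ∀ q, Nat.card {a // orbit a = q} = 2 := by
    rintro ⟨-, a, ha, rfl⟩
    refine Nat.card_eq_two_iff.2 ⟨⟨⟨a, ha⟩, rfl⟩,
      ⟨⟨f a, hP a ha⟩, Subtype.ext ((mk_apply_eq_mk_apply_iff hf).2 (.inr rfl))⟩,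
      fun h => hne a (congrArg (fun x => x.1.1) h).symm, Set.eq_univ_iff_forall.2 ?_⟩
    rintro ⟨⟨b, hb⟩, h⟩
    rcases (mk_apply_eq_mk_apply_iff hf).1 (congrArg Subtype.val h) with rfl | rfl
    exacts [.inl rfl, .inr rfl]
  have := Fintype.ofFinite {q : Sym2 α // ∃ a, P a ∧ q = s(a, f a)}
  rw [← Nat.card_congr (Equiv.sigmaFiberEquiv orbit), Nat.card_sigma]
  simp [hfiber, mul_comm]

theorem natCard_forall_ne_add_natCard [Finite α] {P : α → Prop} {g : β → α}
    (hg : Function.Injective g) (hP : ∀ b, P (g b)) :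
    Nat.card {a // P a ∧ ∀ b, a ≠ g b} + Nat.card β = Nat.card {a // P a} := by
  have hdiff : {a | P a ∧ ∀ b, a ≠ g b} = {a | P a} \ Set.range g := by
    ext a
    simp [eq_comm]
  change Nat.card {a | P a ∧ ∀ b, a ≠ g b} + _ = Nat.card {a | P a}
  rw [Nat.card_coe_set_eq, Nat.card_coe_set_eq, hdiff, ← Set.ncard_range_of_injective hg]
  exact Set.ncard_sdiff_add_ncard_of_subset (Set.range_subset_iff.2 hP)

end Counting

namespace FacePairing

variable {T : Type*} (P : FacePairing T)

theorem pairedFace_involutive : Function.Involutive P.pairedFace := fun F => by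
  simp [pairedFace, P.adj_adj, P.glue_glue]

theorem pairedFace_ne (F : T × Fin 4) : P.pairedFace F ≠ F := P.face_ne F.1 F.2

variable {P} in
theorem VertexStep.symm {x y : T × Fin 4} (h : P.VertexStep x y) : P.VertexStep y x := by
  obtain ⟨i, hi, rfl⟩ := h
  exact ⟨P.glue x.1 i i, (P.glue x.1 i).injective.ne hi, by simp [P.adj_adj, P.glue_glue]⟩

end FacePairing

namespace Triangulation

variable {T : Type*} {𝒯 : Triangulation T}

section IdealVertices

theorem isIdeal_iff_of_vertexStep {x y : T × Fin 4} (h : 𝒯.VertexStep x y) :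
    𝒯.IsIdeal x.1 x.2 ↔ 𝒯.IsIdeal y.1 y.2 := by
  unfold IsIdeal
  rw [Quotient.sound (Relation.EqvGen.rel x y h : 𝒯.vertexSetoid x y)]

theorem isIdeal_glue_iff {t : T} {i v : Fin 4} (h : i ≠ v) :
    𝒯.IsIdeal (𝒯.adj t i) (𝒯.glue t i v) ↔ 𝒯.IsIdeal t v :=
  (isIdeal_iff_of_vertexStep (x := (t, v)) ⟨i, h, rfl⟩).symm

theorem IsExceptional.pairedFace {F : T × Fin 4} (h : 𝒯.IsExceptional F) :
    𝒯.IsExceptional (𝒯.pairedFace F) := by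
  obtain ⟨v, hv, hI⟩ := h
  exact ⟨𝒯.glue F.1 F.2 v, (𝒯.glue F.1 F.2).injective.ne hv, (isIdeal_glue_iff hv.symm).2 hI⟩

theorem isCompactEdge_iff_of_edgeStep {x y : T × TetEdge} (h : 𝒯.EdgeStep x y) :
    𝒯.IsCompactEdge x ↔ 𝒯.IsCompactEdge y := by
  obtain ⟨i, hi, hadj, hmap⟩ := h
  unfold IsCompactEdge
  rw [hadj, hmap]
  simp only [Sym2.mem_map, forall_exists_index, and_imp, forall_apply_eq_imp_iff₂]
  exact forall₂_congr fun v hv =>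
    not_congr (isIdeal_glue_iff (ne_of_mem_of_not_mem hv hi).symm).symm

theorem isCompactEdge_iff_of_mk_eq {x y : T × TetEdge}
    (h : Quotient.mk 𝒯.edgeSetoid x = Quotient.mk 𝒯.edgeSetoid y) :
    𝒯.IsCompactEdge x ↔ 𝒯.IsCompactEdge y :=
  iff_of_eq <| Setoid.eqvGen_le (s := Setoid.ker 𝒯.IsCompactEdge)
    (fun _ _ hxy => propext (isCompactEdge_iff_of_edgeStep hxy)) (Quotient.exact h)

theorem not_isCompactEdge_iff {x : T × TetEdge} :
    ¬ 𝒯.IsCompactEdge x ↔ ∃ v, v ∈ x.2.1 ∧ 𝒯.IsIdeal x.1 v := by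
  simp [IsCompactEdge]

variable (𝒯) in
/-- The tetrahedra with an ideal vertex. -/
abbrev NoncompactTet : Type _ := {t : T // ∃ v, 𝒯.IsIdeal t v}

instance [Finite T] : Fintype 𝒯.NoncompactTet := Fintype.ofFinite _

/-- An ideal vertex of a tetrahedron, which is the only one if the triangulation is good. -/
def NoncompactTet.vertex (t : 𝒯.NoncompactTet) : Fin 4 := t.2.choose

theorem NoncompactTet.isIdeal_vertex (t : 𝒯.NoncompactTet) : 𝒯.IsIdeal t.1 t.vertex :=
  t.2.choose_spec

theorem IsGood.vertex_eq (hgood : 𝒯.IsGood) (t : 𝒯.NoncompactTet) {v : Fin 4}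
    (hv : 𝒯.IsIdeal t.1 v) : t.vertex = v :=
  hgood _ _ _ t.isIdeal_vertex hv

theorem IsGood.natCard_exists_isIdeal [Finite T] (hgood : 𝒯.IsGood) {α : Type*} [Finite α]
    {r : Fin 4 → α → Prop} {n : ℕ} (hr : ∀ v, Nat.card {a // r v a} = n) :
    Nat.card {y : T × α // ∃ v, r v y.2 ∧ 𝒯.IsIdeal y.1 v} = 𝒯.numNoncompactTets * n := by
  let e : {y : T × α // ∃ v, r v y.2 ∧ 𝒯.IsIdeal y.1 v} ≃
      Σ t : 𝒯.NoncompactTet, {a // r t.vertex a} :=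
    { toFun := fun y => ⟨⟨y.1.1, y.2.imp fun _ => And.right⟩, y.1.2, by
        obtain ⟨v, hv, hI⟩ := y.2
        rwa [hgood.vertex_eq ⟨y.1.1, v, hI⟩ hI]⟩
      invFun := fun z => ⟨(z.1.1, z.2.1), z.1.vertex, z.2.2, z.1.isIdeal_vertex⟩
      left_inv := fun _ => rfl
      right_inv := fun _ => rfl }
  rw [Nat.card_congr e, Nat.card_sigma]
  simp [hr, numNoncompactTets]

theorem IsGood.natCard_isExceptional [Finite T] (hgood : 𝒯.IsGood) :
    Nat.card {F // 𝒯.IsExceptional F} = 𝒯.numNoncompactTets * 3 :=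
  hgood.natCard_exists_isIdeal (r := fun v i => v ≠ i) fun v => by
    rw [Nat.card_eq_fintype_card]
    revert v
    decide

theorem IsGood.natCard_isCompactEdge_add [Finite T] (hgood : 𝒯.IsGood) :
    Nat.card {x // 𝒯.IsCompactEdge x} + 𝒯.numNoncompactTets * 3 = Nat.card T * 6 := by
  classical
  have hnot : Nat.card {x // ¬ 𝒯.IsCompactEdge x} = 𝒯.numNoncompactTets * 3 := by
    rw [Nat.card_congr (Equiv.subtypeEquivRight fun _ => not_isCompactEdge_iff)]
    refine hgood.natCard_exists_isIdeal (r := fun v (e : TetEdge) => v ∈ e.1) fun v => ?_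
    rw [Nat.card_eq_fintype_card]
    revert v
    decide
  have hedge : Nat.card TetEdge = 6 := by
    rw [Nat.card_eq_fintype_card]
    decide
  rw [← hnot, ← Nat.card_sum, Nat.card_congr (Equiv.sumCompl 𝒯.IsCompactEdge), Nat.card_prod, hedge]

theorem IsGood.two_mul_natCard_exceptionalPair [Finite T] (hgood : 𝒯.IsGood) :
    2 * Nat.card {q // ∃ F, 𝒯.IsExceptional F ∧ q = s(F, 𝒯.pairedFace F)} =
      𝒯.numNoncompactTets * 3 := by
  rw [← hgood.natCard_isExceptional, natCard_subtype_eq_two_mul 𝒯.pairedFace_involutive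
    𝒯.pairedFace_ne (P := 𝒯.IsExceptional) fun _ => IsExceptional.pairedFace]

theorem IsGood.even_numNoncompactTets [Finite T] (hgood : 𝒯.IsGood) :
    Even 𝒯.numNoncompactTets := by
  have := hgood.two_mul_natCard_exceptionalPair
  rw [Nat.even_iff]
  lia

end IdealVertices

namespace EquationChoice

variable (ch : 𝒯.EquationChoice)

section NumberOfEquations

theorem isCompactEdge_base (E : 𝒯.CompactEdge) : 𝒯.IsCompactEdge (ch.base E) := by
  obtain ⟨x, hx, hcompact⟩ := E.2
  exact (isCompactEdge_iff_of_mk_eq (hx.trans (ch.base_spec E).symm)).1 hcompact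

theorem base_injective : Function.Injective ch.base := fun E E' h =>
  Subtype.ext (by rw [← ch.base_spec E, h, ch.base_spec E'])

theorem exists_isIdeal_drop (κ : 𝒯.Cusp) :
    ∃ v, v ≠ (ch.drop κ).2 ∧ 𝒯.IsIdeal (ch.drop κ).1 v ∧
      Quotient.mk 𝒯.vertexSetoid ((ch.drop κ).1, v) = κ.1 := by
  obtain ⟨v, hne, hv⟩ := ch.drop_spec κ
  refine ⟨v, hne, ?_, hv⟩
  unfold IsIdeal
  exact hv ▸ κ.2

/-- The pair of faces whose `σ`-equation is discarded for the cusp `κ`. -/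
def dropPair (κ : 𝒯.Cusp) : Sym2 (T × Fin 4) := s(ch.drop κ, 𝒯.pairedFace (ch.drop κ))

theorem dropPair_injective (hgood : 𝒯.IsGood) : Function.Injective ch.dropPair := by
  intro κ κ' h
  obtain ⟨v, -, hI, hv⟩ := ch.exists_isIdeal_drop κ
  obtain ⟨w, hw_ne, hI', hw⟩ := ch.exists_isIdeal_drop κ'
  refine Subtype.ext (hv.symm.trans (Eq.trans ?_ hw))
  rcases (mk_apply_eq_mk_apply_iff 𝒯.pairedFace_involutive).1 h with heq | heq
  · rw [heq] at hI ⊢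
    rw [hgood _ _ _ hI hI']
  · rw [heq] at hI ⊢
    rw [hgood _ _ _ hI ((isIdeal_glue_iff hw_ne.symm).2 hI')]
    exact (Quotient.sound (Relation.EqvGen.rel _ _ ⟨_, hw_ne.symm, rfl⟩)).symm

theorem natCard_lengthEq_add [Finite T] :
    Nat.card ch.LengthEq + 𝒯.numCompactEdges = Nat.card {x // 𝒯.IsCompactEdge x} := by
  rw [numCompactEdges, ← natCard_forall_ne_add_natCard ch.base_injective ch.isCompactEdge_base]
  simp only [LengthEq, ne_eq, eq_comm]

theorem natCard_sigmaEq_add [Finite T] (hgood : 𝒯.IsGood) :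
    Nat.card ch.SigmaEq + 𝒯.numCusps =
      Nat.card {q // ∃ F, 𝒯.IsExceptional F ∧ q = s(F, 𝒯.pairedFace F)} :=
  natCard_forall_ne_add_natCard (ch.dropPair_injective hgood) fun κ =>
    ⟨ch.drop κ, (ch.exists_isIdeal_drop κ).imp fun _ h => ⟨h.1, h.2.1⟩, rfl⟩

theorem two_mul_natCard_eqIndex_add [Finite T] (hgood : 𝒯.IsGood) :
    2 * Nat.card ch.EqIndex + 2 * 𝒯.numCompactEdges + 3 * 𝒯.numNoncompactTets + 2 * 𝒯.numCusps =
      12 * Nat.card T := by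
  have hindex : Nat.card ch.EqIndex = Nat.card ch.LengthEq + Nat.card ch.SigmaEq := Nat.card_sum
  have hlength := ch.natCard_lengthEq_add
  have hsigma := ch.natCard_sigmaEq_add hgood
  have hcompact := hgood.natCard_isCompactEdge_add
  have hpair := hgood.two_mul_natCard_exceptionalPair
  lia

end NumberOfEquations

end EquationChoice

end Triangulation

section BalancedFunctions

open Finset

variable {T : Type*}

/-- The sum of a function on the faces of the tetrahedra over the three faces `(t, i)` containing
the vertex `x = (t, v)`. -/
def faceSum (x : T × Fin 4) : (T × Fin 4 → ℝ) →ₗ[ℝ] ℝ :=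
  ∑ i ∈ univ.erase x.2, LinearMap.proj (x.1, i)

theorem faceSum_apply (x : T × Fin 4) (τ : T × Fin 4 → ℝ) :
    faceSum x τ = ∑ i ∈ univ.erase x.2, τ (x.1, i) := by
  simp [faceSum]

namespace Triangulation

variable {𝒯 : Triangulation T}

theorem IsGood.faceSum_single [DecidableEq T] (hgood : 𝒯.IsGood) {t s : T} {i v w : Fin 4}
    (hi : i ≠ v) (hv : 𝒯.IsIdeal t v) (hw : 𝒯.IsIdeal s w) :
    faceSum (s, w) (Pi.single (t, i) 1) = if s = t then 1 else 0 := by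
  simp only [faceSum_apply, Pi.single_apply, Prod.mk.injEq]
  by_cases h : s = t
  · subst h
    simp [hgood s w v hw hv, hi]
  · simp [h]

namespace EquationChoice

variable (ch : 𝒯.EquationChoice)

/-- The face `F` belongs to a discarded pair. -/
def IsDropped (F : T × Fin 4) : Prop := ∃ κ, s(F, 𝒯.pairedFace F) = ch.dropPair κ

/-- The functions on the faces of the tetrahedra that take opposite values on paired faces, except
on the discarded pairs. They satisfy the homogeneous `σ`-equations. -/
def balanced : Submodule ℝ (T × Fin 4 → ℝ) where
  carrier := {τ | ∀ F, ¬ ch.IsDropped F → τ F + τ (𝒯.pairedFace F) = 0}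
  add_mem' hτ hτ' F hF := by
    rw [Pi.add_apply, Pi.add_apply, add_add_add_comm, hτ F hF, hτ' F hF, add_zero]
  zero_mem' F _ := add_zero 0
  smul_mem' c τ hτ F hF := by
    rw [Pi.smul_apply, Pi.smul_apply, ← smul_add, hτ F hF, smul_zero]

variable {ch}

theorem mem_balanced {τ : T × Fin 4 → ℝ} :
    τ ∈ ch.balanced ↔ ∀ F, ¬ ch.IsDropped F → τ F + τ (𝒯.pairedFace F) = 0 := Iff.rfl

theorem isDropped_pairedFace_iff {F : T × Fin 4} :
    ch.IsDropped (𝒯.pairedFace F) ↔ ch.IsDropped F := by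
  unfold IsDropped
  rw [𝒯.pairedFace_involutive F, Sym2.eq_swap]

theorem single_mem_balanced [DecidableEq T] {F : T × Fin 4} (hF : ch.IsDropped F) :
    Pi.single F 1 ∈ ch.balanced := by
  refine mem_balanced.2 fun G hG => ?_
  have hne : G ≠ F := by rintro rfl; exact hG hF
  have hne' : 𝒯.pairedFace G ≠ F := by rintro rfl; exact hG (isDropped_pairedFace_iff.1 hF)
  simp [hne, hne']

theorem single_pairedFace_sub_single_mem_balanced [DecidableEq T] (F : T × Fin 4) :
    Pi.single (𝒯.pairedFace F) 1 - Pi.single F 1 ∈ ch.balanced := by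
  refine mem_balanced.2 fun G _ => ?_
  have hG : G = 𝒯.pairedFace F ↔ 𝒯.pairedFace G = F := by
    rw [eq_comm, 𝒯.pairedFace_involutive.eq_iff, eq_comm]
  simp only [Pi.sub_apply, Pi.single_apply, hG, 𝒯.pairedFace_involutive.injective.eq_iff]
  ring

open Classical in
variable (ch) in
/-- Some balanced function has sum `1` over the faces of the tetrahedron `t` that contain its ideal
vertex, and sum `0` for all the other tetrahedra with an ideal vertex. -/
def HasUnitFlow (t : T) : Prop :=
  ∃ τ ∈ ch.balanced, ∀ s w, 𝒯.IsIdeal s w → faceSum (s, w) τ = if s = t then 1 else 0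

theorem hasUnitFlow_drop (hgood : 𝒯.IsGood) (κ : 𝒯.Cusp) : ch.HasUnitFlow (ch.drop κ).1 := by
  classical
  obtain ⟨v, hne, hv, -⟩ := ch.exists_isIdeal_drop κ
  exact ⟨_, single_mem_balanced ⟨κ, rfl⟩, fun s w hw => hgood.faceSum_single hne.symm hv hw⟩

/-- A unit of mass is moved from a face of `t` to the face glued to it. -/
theorem HasUnitFlow.adj (hgood : 𝒯.IsGood) {t : T} {i v : Fin 4} (h : ch.HasUnitFlow t)
    (hi : i ≠ v) (hv : 𝒯.IsIdeal t v) : ch.HasUnitFlow (𝒯.adj t i) := by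
  classical
  obtain ⟨τ, hτ, hsum⟩ := h
  refine ⟨τ + (Pi.single (𝒯.pairedFace (t, i)) 1 - Pi.single (t, i) 1),
    add_mem hτ (single_pairedFace_sub_single_mem_balanced _), fun s w hw => ?_⟩
  rw [map_add, map_sub, hsum s w hw, hgood.faceSum_single hi hv hw, FacePairing.pairedFace,
    hgood.faceSum_single ((𝒯.glue t i).injective.ne hi) ((isIdeal_glue_iff hi).2 hv) hw]
  ring

theorem hasUnitFlow_of_vertexStep (hgood : 𝒯.IsGood) {x y : T × Fin 4} (h : 𝒯.VertexStep x y)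
    (hx : 𝒯.IsIdeal x.1 x.2 → ch.HasUnitFlow x.1) (hy : 𝒯.IsIdeal y.1 y.2) :
    ch.HasUnitFlow y.1 := by
  have hv := (isIdeal_iff_of_vertexStep h).2 hy
  obtain ⟨i, hi, rfl⟩ := h
  exact (hx hv).adj hgood hi hv

theorem hasUnitFlow (hgood : 𝒯.IsGood) {t : T} {v : Fin 4} (hv : 𝒯.IsIdeal t v) :
    ch.HasUnitFlow t := by
  obtain ⟨w, -, _, hdrop⟩ := ch.exists_isIdeal_drop ⟨_, hv⟩
  have hconst := Setoid.eqvGen_le (r := 𝒯.VertexStep)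
    (s := Setoid.ker fun x : T × Fin 4 => 𝒯.IsIdeal x.1 x.2 → ch.HasUnitFlow x.1)
    (fun _ _ h => propext ⟨hasUnitFlow_of_vertexStep hgood h,
      hasUnitFlow_of_vertexStep hgood h.symm⟩) (Quotient.exact hdrop)
  exact (iff_of_eq hconst).1 (fun _ => hasUnitFlow_drop hgood _) hv

theorem exists_balanced_faceSum_eq [Finite T] (hgood : 𝒯.IsGood) (m : 𝒯.NoncompactTet → ℝ) :
    ∃ τ ∈ ch.balanced, ∀ t : 𝒯.NoncompactTet, faceSum (t.1, t.vertex) τ = m t := by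
  classical
  choose flow hflow hsum using fun t : 𝒯.NoncompactTet =>
    hasUnitFlow (ch := ch) hgood t.isIdeal_vertex
  refine ⟨∑ t, m t • flow t, sum_mem fun t _ => Submodule.smul_mem _ _ (hflow t), fun t => ?_⟩
  simp [hsum _ _ _ t.isIdeal_vertex, ← Subtype.ext_iff]

theorem exists_add_eq_faceSum_eq_zero [Finite T] (hgood : 𝒯.IsGood) (c : Sym2 (T × Fin 4) → ℝ) :
    ∃ τ : T × Fin 4 → ℝ,
      (∀ F, ¬ ch.IsDropped F → τ F + τ (𝒯.pairedFace F) = c s(F, 𝒯.pairedFace F)) ∧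
      ∀ t v, 𝒯.IsIdeal t v → ∑ i ∈ univ.erase v, τ (t, i) = 0 := by
  let half : T × Fin 4 → ℝ := fun F => c s(F, 𝒯.pairedFace F) / 2
  have hhalf : ∀ F, half F + half (𝒯.pairedFace F) = c s(F, 𝒯.pairedFace F) := fun F => by
    simp only [half, 𝒯.pairedFace_involutive F, Sym2.eq_swap (a := 𝒯.pairedFace F), add_halves]
  obtain ⟨τ, hτ, hsum⟩ := exists_balanced_faceSum_eq (ch := ch) hgood
    fun t => faceSum (t.1, t.vertex) half
  refine ⟨half - τ, fun F hF => ?_, fun t v hv => ?_⟩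
  · rw [Pi.sub_apply, Pi.sub_apply, sub_add_sub_comm, hhalf, mem_balanced.1 hτ F hF, sub_zero]
  · have hvertex := hgood.vertex_eq ⟨t, v, hv⟩ hv
    have := hsum ⟨t, v, hv⟩
    rw [hvertex] at this
    rw [← faceSum_apply (t, v), map_sub, this, sub_self]

end EquationChoice

end Triangulation

end BalancedFunctions

section MatchingMap

variable {T : Type*}

/-- The restriction to the edges of the tetrahedron `t` of a function on the edges of all the
tetrahedra. -/
def restrictTet (t : T) : (T × TetEdge → ℝ) →L[ℝ] (TetEdge → ℝ) :=
  ContinuousLinearMap.pi fun e => ContinuousLinearMap.proj (t, e)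

namespace Triangulation

variable {𝒯 : Triangulation T} {x : T × TetEdge → ℝ}

variable (𝒯) in
/-- The ideal vertices of the tetrahedron `t`. -/
def idealVertices (t : T) : Set (Fin 4) := {v | 𝒯.IsIdeal t v}

theorem IsGood.subsingleton_idealVertices (hgood : 𝒯.IsGood) (t : T) :
    (𝒯.idealVertices t).Subsingleton :=
  fun _ hv _ hw => hgood t _ _ hv hw

variable (𝒯) in
/-- The angle assignments that are admissible on every tetrahedron: a neighbourhood of the moduli
space on which the matching map is smooth. -/
def admissible : Set (T × TetEdge → ℝ) :=
  {x | ∀ t, IsAdmissible (𝒯.idealVertices t) (restrictTet t x)}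

theorem isOpen_admissible [Finite T] : IsOpen 𝒯.admissible := by
  simp only [admissible, Set.ofPred_forall]
  exact isOpen_iInter_of_finite fun t =>
    (isOpen_setOf_isAdmissible _).preimage (restrictTet t).continuous

theorem isGeometric_restrictTet (hx : x ∈ 𝒯.moduli) (t : T) :
    IsGeometric (𝒯.idealVertices t) (restrictTet t x) where
  mem_Ioo _ _ h := ang_of_ne h (restrictTet t x) ▸ hx.1 t _
  angleSum_eq v := (hx.2 t v).1
  angleSum_lt v := (hx.2 t v).2

theorem moduli_subset_admissible : 𝒯.moduli ⊆ 𝒯.admissible :=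
  fun _ hx t => (isGeometric_restrictTet hx t).isAdmissible

theorem mem_moduli_iff (hx : x ∈ 𝒯.admissible) :
    x ∈ 𝒯.moduli ↔ ∀ t v, 𝒯.IsIdeal t v → angleSum (restrictTet t x) v = Real.pi := by
  refine ⟨fun h t v => (h.2 t v).1,
    fun h => ⟨fun t e => ?_, fun t v => ⟨h t v, (hx t).angleSum_lt v⟩⟩⟩
  obtain ⟨a, b, hab, rfl⟩ := e.exists_eq_mk
  have hmem := (hx t).mem_Ioo a b hab
  rwa [ang_of_ne hab] at hmem

theorem IsGood.sigma_eq (hgood : 𝒯.IsGood) {F : T × Fin 4} {v : Fin 4} (hv : v ≠ F.2)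
    (hI : 𝒯.IsIdeal F.1 v) (x : T × TetEdge → ℝ) :
    𝒯.sigma x F = sigmaAt (restrictTet F.1 x) F.2 v := by
  have h : 𝒯.IsExceptional F := ⟨v, hv, hI⟩
  rw [sigma, dif_pos h, hgood _ _ _ h.choose_spec.2 hI]
  rfl

section Derivatives

variable [Fintype T]

theorem contDiffAt_edgeLength (hx : x ∈ 𝒯.admissible) {y : T × TetEdge} (hy : 𝒯.IsCompactEdge y)
    {n : ℕ∞ω} : ContDiffAt ℝ n (fun x => edgeLength (restrictTet y.1 x) y.2) x :=
  ((hx y.1).contDiffAt_edgeLength hy).comp x (restrictTet y.1).contDiff.contDiffAt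

theorem hasFDerivAt_edgeLength (hx : x ∈ 𝒯.admissible) {y : T × TetEdge}
    (hy : 𝒯.IsCompactEdge y) :
    HasFDerivAt (fun x => edgeLength (restrictTet y.1 x) y.2)
      ((fderiv ℝ (fun θ => edgeLength θ y.2) (restrictTet y.1 x)).comp (restrictTet y.1)) x :=
  ((hx y.1).hasFDerivAt_edgeLength hy).comp x (restrictTet y.1).hasFDerivAt

theorem IsGood.contDiffAt_sigma (hgood : 𝒯.IsGood) (hx : x ∈ 𝒯.admissible) {F : T × Fin 4}
    (hF : 𝒯.IsExceptional F) {n : ℕ∞ω} : ContDiffAt ℝ n (fun x => 𝒯.sigma x F) x := by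
  obtain ⟨v, hv, hI⟩ := hF
  simp only [hgood.sigma_eq hv hI]
  exact ((hx F.1).contDiffAt_sigmaAt (hgood.subsingleton_idealVertices F.1) hI hv.symm).comp x
    (restrictTet F.1).contDiff.contDiffAt

theorem IsGood.hasFDerivAt_sigma (hgood : 𝒯.IsGood) (hx : x ∈ 𝒯.admissible) {F : T × Fin 4}
    {v : Fin 4} (hv : v ≠ F.2) (hI : 𝒯.IsIdeal F.1 v) :
    HasFDerivAt (fun x => 𝒯.sigma x F)
      ((fderiv ℝ (fun θ => sigmaAt θ F.2 v) (restrictTet F.1 x)).comp (restrictTet F.1)) x := by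
  simp only [hgood.sigma_eq hv hI]
  exact ((hx F.1).hasFDerivAt_sigmaAt (hgood.subsingleton_idealVertices F.1) hI hv.symm).comp x
    (restrictTet F.1).hasFDerivAt

end Derivatives

namespace EquationChoice

variable (ch : 𝒯.EquationChoice)

/-- The representative of the class of a compact edge of a tetrahedron. -/
def classBase {y : T × TetEdge} (hy : 𝒯.IsCompactEdge y) : T × TetEdge :=
  ch.base ⟨Quotient.mk 𝒯.edgeSetoid y, y, rfl, hy⟩

theorem isCompactEdge_classBase {y : T × TetEdge} (hy : 𝒯.IsCompactEdge y) :
    𝒯.IsCompactEdge (ch.classBase hy) :=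
  ch.isCompactEdge_base _

section Derivatives

variable [Fintype T]

theorem contDiffAt_matchingMap (hgood : 𝒯.IsGood) (hx : x ∈ 𝒯.admissible) {n : ℕ∞ω} :
    ContDiffAt ℝ n ch.matchingMap x := by
  rw [contDiffAt_pi]
  rintro (y | ⟨_, ⟨F, hF, rfl⟩, _⟩)
  · exact (contDiffAt_edgeLength hx y.2.1).sub (contDiffAt_edgeLength hx (ch.isCompactEdge_base _))
  · exact (hgood.contDiffAt_sigma hx hF).add (hgood.contDiffAt_sigma hx hF.pairedFace)

theorem hasFDerivAt_matchingMap (hgood : 𝒯.IsGood) (hx : x ∈ 𝒯.admissible) :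
    HasFDerivAt ch.matchingMap (fderiv ℝ ch.matchingMap x) x :=
  ((ch.contDiffAt_matchingMap hgood hx).differentiableAt one_ne_zero).hasFDerivAt

theorem fderiv_matchingMap_inl (hgood : 𝒯.IsGood) (hx : x ∈ 𝒯.admissible) (y : ch.LengthEq)
    (ξ : T × TetEdge → ℝ) :
    fderiv ℝ ch.matchingMap x ξ (Sum.inl y) =
      fderiv ℝ (fun x => edgeLength (restrictTet y.1.1 x) y.1.2) x ξ -
        fderiv ℝ (fun x => edgeLength (restrictTet (ch.classBase y.2.1).1 x)
          (ch.classBase y.2.1).2) x ξ := by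
  have hy := hasFDerivAt_edgeLength hx y.2.1
  have hbase := hasFDerivAt_edgeLength hx (ch.isCompactEdge_classBase y.2.1)
  have h := (hasFDerivAt_pi'.1 (ch.hasFDerivAt_matchingMap hgood hx) (Sum.inl y)).unique
    (hy.sub hbase)
  rw [hy.fderiv, hbase.fderiv]
  exact DFunLike.congr_fun h ξ

theorem fderiv_matchingMap_inr (hgood : 𝒯.IsGood) (hx : x ∈ 𝒯.admissible) {F : T × Fin 4}
    (hF : 𝒯.IsExceptional F) (hdrop : ¬ ch.IsDropped F) (ξ : T × TetEdge → ℝ) :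
    fderiv ℝ ch.matchingMap x ξ
        (Sum.inr ⟨s(F, 𝒯.pairedFace F), ⟨F, hF, rfl⟩, not_exists.1 hdrop⟩) =
      fderiv ℝ (fun x => 𝒯.sigma x F) x ξ + fderiv ℝ (fun x => 𝒯.sigma x (𝒯.pairedFace F)) x ξ := by
  have hsigma : ∀ {F}, 𝒯.IsExceptional F →
      HasFDerivAt (fun x => 𝒯.sigma x F) (fderiv ℝ (fun x => 𝒯.sigma x F) x) x := fun hF =>
    ((hgood.contDiffAt_sigma hx hF).differentiableAt one_ne_zero).hasFDerivAt
  have h := (hasFDerivAt_pi'.1 (ch.hasFDerivAt_matchingMap hgood hx)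
    (Sum.inr ⟨s(F, 𝒯.pairedFace F), ⟨F, hF, rfl⟩, not_exists.1 hdrop⟩)).unique
    ((hsigma hF).add (hsigma hF.pairedFace))
  exact DFunLike.congr_fun h ξ

theorem exists_fderiv_edgeLength_sigma_eq (hgood : 𝒯.IsGood) (hx : x ∈ 𝒯.moduli)
    (l : T × TetEdge → ℝ) {τ : T × Fin 4 → ℝ} (m : T → ℝ)
    (hτ : ∀ t v, 𝒯.IsIdeal t v → ∑ i ∈ Finset.univ.erase v, τ (t, i) = 0) :
    ∃ ξ : T × TetEdge → ℝ, (∀ t v, 𝒯.IsIdeal t v → angleSum (restrictTet t ξ) v = m t) ∧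
      (∀ y, 𝒯.IsCompactEdge y →
        fderiv ℝ (fun x => edgeLength (restrictTet y.1 x) y.2) x ξ = l y) ∧
      ∀ F, 𝒯.IsExceptional F → fderiv ℝ (fun x => 𝒯.sigma x F) x ξ = τ F := by
  choose ξ hsum hlength hsigma using fun t => (isGeometric_restrictTet hx t).exists_fderiv_eq
    (hgood.subsingleton_idealVertices t) (fun e => l (t, e)) (fun i => τ (t, i)) (m t) (hτ t)
  have hadm := moduli_subset_admissible hx
  refine ⟨fun y => ξ y.1 y.2, hsum, fun y hy => ?_, ?_⟩
  · rw [(hasFDerivAt_edgeLength hadm hy).fderiv]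
    exact hlength y.1 y.2 hy
  · rintro F ⟨v, hv, hI⟩
    rw [(hgood.hasFDerivAt_sigma hadm hv hI).fderiv]
    exact hsigma F.1 F.2 v hv.symm hI

theorem exists_fderiv_matchingMap_eq (hgood : 𝒯.IsGood) (hx : x ∈ 𝒯.moduli) (c : ch.EqIndex → ℝ)
    (m : T → ℝ) :
    ∃ ξ : T × TetEdge → ℝ, (∀ t v, 𝒯.IsIdeal t v → angleSum (restrictTet t ξ) v = m t) ∧
      fderiv ℝ ch.matchingMap x ξ = c := by
  let l : T × TetEdge → ℝ := Function.extend Subtype.val (c ∘ Sum.inl) 0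
  let s : Sym2 (T × Fin 4) → ℝ := Function.extend Subtype.val (c ∘ Sum.inr) 0
  obtain ⟨τ, hpair, hτ⟩ := exists_add_eq_faceSum_eq_zero (ch := ch) hgood s
  obtain ⟨ξ, hsum, hlength, hsigma⟩ := exists_fderiv_edgeLength_sigma_eq hgood hx l m hτ
  have hadm := moduli_subset_admissible hx
  refine ⟨ξ, hsum, funext ?_⟩
  rintro (y | ⟨_, ⟨F, hF, rfl⟩, hdrop⟩)
  · have hl : l y = c (Sum.inl y) := Subtype.val_injective.extend_apply _ _ y
    have hl_base : l (ch.classBase y.2.1) = 0 :=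
      Function.extend_apply' _ _ _ fun ⟨z, hz⟩ => z.2.2 _ hz.symm
    rw [ch.fderiv_matchingMap_inl hgood hadm, hlength _ y.2.1,
      hlength _ (ch.isCompactEdge_classBase y.2.1), hl, hl_base, sub_zero]
  · have hdrop' : ¬ ch.IsDropped F := not_exists.2 hdrop
    rw [ch.fderiv_matchingMap_inr hgood hadm hF hdrop', hsigma F hF, hsigma _ hF.pairedFace,
      hpair F hdrop']
    exact Subtype.val_injective.extend_apply (c ∘ Sum.inr) 0
      (⟨s(F, 𝒯.pairedFace F), ⟨F, hF, rfl⟩, hdrop⟩ : ch.SigmaEq)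

theorem surjective_fderiv_matchingMap (hgood : 𝒯.IsGood) (hx : x ∈ 𝒯.moduli) :
    Function.Surjective fun ξ : 𝒯.moduliTangent => fderiv ℝ ch.matchingMap x ξ := by
  intro c
  obtain ⟨ξ, hξ, hc⟩ := ch.exists_fderiv_matchingMap_eq hgood hx c 0
  exact ⟨⟨ξ, hξ⟩, hc⟩

end Derivatives

end EquationChoice

end Triangulation

end MatchingMap

section ConeStructures

namespace Triangulation

variable {T : Type*} {𝒯 : Triangulation T} {x : T × TetEdge → ℝ}

variable (𝒯) in
/-- The defects from `π` of the angle sums at the ideal vertices: among admissible angle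
assignments, their vanishing characterizes the moduli space. -/
def angleDefect (x : T × TetEdge → ℝ) (t : 𝒯.NoncompactTet) : ℝ :=
  angleSum (restrictTet t.1 x) t.vertex - Real.pi

theorem IsGood.mem_moduli_iff_angleDefect_eq_zero (hgood : 𝒯.IsGood) (hx : x ∈ 𝒯.admissible) :
    x ∈ 𝒯.moduli ↔ 𝒯.angleDefect x = 0 := by
  rw [mem_moduli_iff hx]
  refine ⟨fun h => funext fun t => sub_eq_zero.2 (h _ _ t.isIdeal_vertex), fun h t v hv => ?_⟩
  rw [← hgood.vertex_eq ⟨t, v, hv⟩ hv]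
  exact sub_eq_zero.1 (congrFun h ⟨t, v, hv⟩)

theorem hasFDerivAt_angleDefect [Fintype T] (x : T × TetEdge → ℝ) :
    HasFDerivAt 𝒯.angleDefect (ContinuousLinearMap.pi fun t : 𝒯.NoncompactTet =>
      (angleSumCLM t.vertex).comp (restrictTet t.1)) x := by
  refine hasFDerivAt_pi.2 fun t => ?_
  simp only [angleDefect, ← angleSumCLM_apply]
  exact ((angleSumCLM t.vertex).comp (restrictTet t.1)).hasFDerivAt.sub_const Real.pi

theorem contDiff_angleDefect [Fintype T] {n : ℕ∞ω} :
    ContDiff ℝ n 𝒯.angleDefect := by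
  refine contDiff_pi.2 fun t => ?_
  simp only [angleDefect, ← angleSumCLM_apply]
  exact ((angleSumCLM t.vertex).comp (restrictTet t.1)).contDiff.sub contDiff_const

namespace EquationChoice

variable (ch : 𝒯.EquationChoice)

/-- The matching map together with the defects of the angle sums, whose zeros among the admissible
angle assignments are the cone structures. -/
def extendedMap (x : T × TetEdge → ℝ) : (ch.EqIndex → ℝ) × (𝒯.NoncompactTet → ℝ) :=
  (ch.matchingMap x, 𝒯.angleDefect x)

theorem mem_coneStructures_iff (hgood : 𝒯.IsGood) (hx : x ∈ 𝒯.admissible) :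
    x ∈ ch.coneStructures ↔ ch.extendedMap x = 0 := by
  rw [coneStructures, Set.mem_ofPred_eq, hgood.mem_moduli_iff_angleDefect_eq_zero hx, and_comm,
    extendedMap, Prod.mk_eq_zero]

variable [Fintype T]

theorem contDiffOn_extendedMap (hgood : 𝒯.IsGood) {n : ℕ∞ω} :
    ContDiffOn ℝ n ch.extendedMap 𝒯.admissible := fun _ hx =>
  ((ch.contDiffAt_matchingMap hgood hx).prodMk contDiff_angleDefect.contDiffAt).contDiffWithinAt

theorem surjective_fderiv_extendedMap (hgood : 𝒯.IsGood) (hx : x ∈ 𝒯.moduli) :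
    Function.Surjective (fderiv ℝ ch.extendedMap x) := by
  rintro ⟨c, m⟩
  obtain ⟨ξ, hsum, hc⟩ :=
    ch.exists_fderiv_matchingMap_eq hgood hx c (Function.extend Subtype.val m 0)
  have hderiv := (ch.hasFDerivAt_matchingMap hgood (moduli_subset_admissible hx)).prodMk
    (hasFDerivAt_angleDefect (𝒯 := 𝒯) x)
  refine ⟨ξ, (DFunLike.congr_fun hderiv.fderiv ξ).trans (Prod.ext hc (funext fun t => ?_))⟩
  have hm := hsum t.1 t.vertex t.isIdeal_vertex
  rw [Subtype.val_injective.extend_apply] at hm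
  exact (angleSumCLM_apply _ _).trans hm

theorem isSmoothManifoldNear_coneStructures (hgood : 𝒯.IsGood) (hx : x ∈ ch.coneStructures) :
    IsSmoothManifoldNear ch.coneStructures
      (𝒯.numCompactEdges + 𝒯.numNoncompactTets / 2 + 𝒯.numCusps) x := by
  refine isSmoothManifoldNear_of_surjective_fderiv isOpen_admissible
    (ch.contDiffOn_extendedMap hgood) (fun _ hy => ch.mem_coneStructures_iff hgood hy)
    (moduli_subset_admissible hx.1) hx (ch.surjective_fderiv_extendedMap hgood hx.1) ?_
  have hequations := ch.two_mul_natCard_eqIndex_add hgood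
  have hnoncompact : Nat.card 𝒯.NoncompactTet = 𝒯.numNoncompactTets := rfl
  have hedge : Fintype.card TetEdge = 6 := by decide
  obtain ⟨r, hr⟩ := hgood.even_numNoncompactTets
  rw [Module.finrank_prod, Module.finrank_fintype_fun_eq_card, Module.finrank_fintype_fun_eq_card,
    Module.finrank_fintype_fun_eq_card, Fintype.card_prod, hedge]
  simp only [Nat.card_eq_fintype_card] at hequations hnoncompact
  lia

end EquationChoice

end Triangulation

end ConeStructures

end TruncTri

end

open scoped ContDiff in
theorem mainTheorem9 {T : Type*} [Fintype T] (𝒯 : TruncTri.Triangulation T)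
    (hgood : 𝒯.IsGood) (ch : 𝒯.EquationChoice) :
    Even 𝒯.numNoncompactTets ∧
    (Fintype.card ch.EqIndex : ℝ) = 6 * (Fintype.card T : ℝ) - (𝒯.numCompactEdges : ℝ)
      - (3 / 2 : ℝ) * (𝒯.numNoncompactTets : ℝ) - (𝒯.numCusps : ℝ) ∧
    (∀ x ∈ 𝒯.moduli,
      ContDiffAt ℝ ∞ ch.matchingMap x ∧
      Function.Surjective
        (fun ξ : 𝒯.moduliTangent => fderiv ℝ ch.matchingMap x (ξ : T × TruncTri.TetEdge → ℝ))) ∧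
    (∀ x₀ ∈ ch.coneStructures,
      TruncTri.IsSmoothManifoldNear ch.coneStructures
        (𝒯.numCompactEdges + 𝒯.numNoncompactTets / 2 + 𝒯.numCusps) x₀) := by
  refine ⟨hgood.even_numNoncompactTets, ?_, fun x hx => ⟨?_, ?_⟩, fun x₀ hx₀ => ?_⟩
  · have hcard := congrArg (Nat.cast (R := ℝ)) (ch.two_mul_natCard_eqIndex_add hgood)
    simp only [Nat.card_eq_fintype_card] at hcard
    push_cast at hcard
    linarith
  · exact ch.contDiffAt_matchingMap hgood (TruncTri.Triangulation.moduli_subset_admissible hx)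
  · exact ch.surjective_fderiv_matchingMap hgood hx
  · exact ch.isSmoothManifoldNear_coneStructures hgood hx₀
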